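/- **Setting.** Fix $J$ goods, $\pi\in(0,1)$ and a class $\mathcal G$ of individual types, sampled from a probability distribution $\Theta$. A type carries an outcome function $Y(w,p)\in\mathbb R$, a demand function $D(w,p)\in\mathbb R^J$ and a supply function $S(w,p)\in\mathbb R^J$ of the own binary treatment $w\in\{0,1\}$ and the price vector $p\in\mathbb R^J$, jointly measurable in (type, $p$); $Z=D-S$ is excess demand. Let $y(w,p)=\mathbb E[Y_i(w,p)]$, $z_\pi(p)=\pi\,\mathbb E[Z_i(1,p)]+(1-\pi)\,\mathbb E[Z_i(0,p)]$, and $\mathcal S=\{p: l\le p\le u\}$ for vectors $l,u>0$. A mean-field price is a $p\in\mathcal S$ with $z_\pi(p)=0$. **Assumptions.** (1) For all types, both $w$ and all goods $j$: $Z_{ij}(w,p)\le 0$ whenever $p_j\ge u_j$, and $Z_{ij}(w,p)\ge0$ whenever $p_j\le l_j$; for each $w$, $j$ and each of the two inequalities there is a set of types of positive $\Theta$-measure on which it is strict for all such $p$. (2) For some $\delta>0$, the functions $Y,D,S$ are twice continuously differentiable in $p$ around every point of $\{p: l_j-\delta\le p_j\le u_j+\delta\ \forall j\}$, with derivatives of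 orders $0,1,2$ bounded there uniformly over types and $w$. (3) At a mean-field price $p^*$ the Jacobian $\nabla_p z_\pi(p^*)$ and the matrix $\mathbb E[Z_i(W_i,p^*)Z_i(W_i,p^*)^\top]$ have full rank, and the operator norm of the Jacobian of $p\mapsto z_\pi(p)+p$ is less than $1$ at every $p\in\mathcal S$. (4) For some $B>0$ and some sequence $a_n$ with $n a_n\to0$, almost surely for all sufficiently large $n$: for every $n\times J$ matrix $V$ with entries bounded by $B$ in absolute value, and also if one of the treatments $W_1,\dots,W_n$ is replaced by a fixed value, there is a price $p_n$ with $\|\frac1n\sum_{i=1}^n Z_i(W_i,p_n+V_i)\|\le a_n$. **Experiment.** For each $n$ the individuals $i\le n$ are i.i.d.; the type of $i$ is drawn from $\Theta$, $W_i\sim\mathrm{Bernoulli}(\pi)$, and the $U_{ij}$ ($j\le J$) are uniform on $\{-h_n,h_n\}$ with $h_n=cn^{-\alpha}$, $c>0$, $\frac14<\alpha<\frac12$, all independent. The market price $\tilde P$ is any measurable minimizer over $p\in\mathbb R^J$ of $\|\frac1n\sum_{i=1}^n Z_i(W_i,p+U_i)\|$. With $Y_i=Y_i(W_i,\tilde P+U_i)$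 let $$\hat\tau_{\mathrm{ADE}}=\frac1n\sum_{i=1}^n\Big(\frac{W_iY_i}{\pi}-\frac{(1-W_i)Y_i}{1-\pi}\Big).$$ **Theorem.** There is exactly one mean-field price $p^*_\pi\in\mathcal S$. With $\tau^*_{\mathrm{ADE}}=y(1,p^*_\pi)-y(0,p^*_\pi)$, $$\sqrt n\,(\hat\tau_{\mathrm{ADE}}-\tau^*_{\mathrm{ADE}})\ \to_d\ N(0,\sigma_D^2),\qquad \sigma_D^2=\pi(1-\pi)\,\mathbb E[R_i^2]+\mathrm{Var}[T_i],$$ where $$R_i=\frac{Y_i(1,p^*_\pi)}{\pi}+\frac{Y_i(0,p^*_\pi)}{1-\pi}-a^\top H^{-1}\big(Z_i(1,p^*_\pi)-Z_i(0,p^*_\pi)\big),$$ $$T_i=Y_i(1,p^*_\pi)-Y_i(0,p^*_\pi)-a^\top H^{-1}\big(\pi Z_i(1,p^*_\pi)+(1-\pi)Z_i(0,p^*_\pi)\big),$$ $H=\nabla_p z_\pi(p^*_\pi)$ is the Jacobian of $z_\pi$ (with entries $H_{jk}=\partial z_{\pi,j}/\partial p_k$) and $a=\nabla_p[y(1,p)-y(0,p)]$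 at $p=p^*_\pi$. -/

import Mathlib

open MeasureTheory ProbabilityTheory Filter Topology
open scoped ENNReal

/-- Price vectors (and vectors of quantities) for `J` goods, with the Euclidean norm. -/
abbrev Price (J : ℕ) : Type := EuclideanSpace ℝ (Fin J)

/-- The class `𝒢` of individual types: every type `g : 𝒢` carries an outcome function, a demand
function and a supply function of the own treatment `w` (`true` is treated, `false` is control)
and of the price vector `p`. -/
structure Market (𝒢 : Type*) [MeasurableSpace 𝒢] (J : ℕ) where
  outcome : 𝒢 → Bool → Price J → ℝ
  demand : 𝒢 → Bool → Price J → Price J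
  supply : 𝒢 → Bool → Price J → Price J
  measurable_outcome : ∀ w, Measurable fun q : 𝒢 × Price J => outcome q.1 w q.2
  measurable_demand : ∀ w, Measurable fun q : 𝒢 × Price J => demand q.1 w q.2
  measurable_supply : ∀ w, Measurable fun q : 𝒢 × Price J => supply q.1 w q.2

/-- The box `{p : l j - δ ≤ p j ≤ u j + δ for all j}`; for `δ = 0` it is the price box
`𝒮 = {p : l ≤ p ≤ u}`. -/
def priceBox {J : ℕ} (l u : Price J) (δ : ℝ) : Set (Price J) :=
  {p | ∀ j, l j - δ ≤ p j ∧ p j ≤ u j + δ}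

/-- `f` is twice continuously differentiable around every point of `s`, and its derivatives of
order `0`, `1`, `2` are bounded by `C` on `s`. -/
def SmoothBoundedOn {J : ℕ} {F : Type*} [NormedAddCommGroup F] [NormedSpace ℝ F]
    (f : Price J → F) (s : Set (Price J)) (C : ℝ) : Prop :=
  ∀ p ∈ s, ContDiffAt ℝ 2 f p ∧ ∀ r : ℕ, r ≤ 2 → ‖iteratedFDeriv ℝ r f p‖ ≤ C

/-- The law of a Bernoulli treatment with success probability `π`. -/
noncomputable def treatmentLaw (π : ℝ) : Measure Bool :=
  ENNReal.ofReal π • Measure.dirac true + ENNReal.ofReal (1 - π) • Measure.dirac false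

/-- The uniform distribution on the two points `-h` and `h`. -/
noncomputable def signLaw (h : ℝ) : Measure ℝ :=
  (2⁻¹ : ℝ≥0∞) • Measure.dirac (-h) + (2⁻¹ : ℝ≥0∞) • Measure.dirac h

/-- The law of a price perturbation: `J` independent coordinates, uniform on `{-h, h}`. -/
noncomputable def perturbationLaw (J : ℕ) (h : ℝ) : Measure (Price J) :=
  (Measure.pi fun _ : Fin J => signLaw h).map (WithLp.toLp 2)

namespace Market

variable {𝒢 : Type*} [MeasurableSpace 𝒢] {J : ℕ}

/-- Individual excess demand. -/
def excess (M : Market 𝒢 J) (g : 𝒢) (w : Bool) (p : Price J) : Price J :=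
  M.demand g w p - M.supply g w p

/-- The average excess demand `(1/n) ∑ᵢ Zᵢ(Wᵢ, p + Uᵢ)` of a sample of `n` individuals. -/
noncomputable def avgExcess (M : Market 𝒢 J) {n : ℕ} (g : Fin n → 𝒢) (W : Fin n → Bool)
    (U : Fin n → Price J) (p : Price J) : Price J :=
  (n : ℝ)⁻¹ • ∑ i, M.excess (g i) (W i) (p + U i)

/-- `P` is a market-clearing price: a price that comes closest to clearing the market. -/
def IsClearingPrice (M : Market 𝒢 J) {n : ℕ} (g : Fin n → 𝒢) (W : Fin n → Bool)
    (U : Fin n → Price J) (P : Price J) : Prop :=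
  ∀ p : Price J, ‖M.avgExcess g W U P‖ ≤ ‖M.avgExcess g W U p‖

/-- Expected outcome `y(w, p)`. -/
noncomputable def meanOutcome (M : Market 𝒢 J) (Θ : Measure 𝒢) (w : Bool) (p : Price J) : ℝ :=
  ∫ g, M.outcome g w p ∂Θ

/-- Expected demand `d(w, p)`. -/
noncomputable def meanDemand (M : Market 𝒢 J) (Θ : Measure 𝒢) (w : Bool) (p : Price J) :
    Price J :=
  ∫ g, M.demand g w p ∂Θ

/-- Expected supply `s(w, p)`. -/
noncomputable def meanSupply (M : Market 𝒢 J) (Θ : Measure 𝒢) (w : Bool) (p : Price J) :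
    Price J :=
  ∫ g, M.supply g w p ∂Θ

/-- Mean-field excess demand `z_π(p)`. -/
noncomputable def meanExcess (M : Market 𝒢 J) (Θ : Measure 𝒢) (π : ℝ) (p : Price J) : Price J :=
  π • (M.meanDemand Θ true p - M.meanSupply Θ true p)
    + (1 - π) • (M.meanDemand Θ false p - M.meanSupply Θ false p)

/-- `p` is a mean-field equilibrium price: a price in the box at which the mean-field excess
demand vanishes. -/
def IsMeanFieldPrice (M : Market 𝒢 J) (Θ : Measure 𝒢) (π : ℝ) (l u p : Price J) : Prop :=
  p ∈ priceBox l u 0 ∧ M.meanExcess Θ π p = 0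

/-- The Jacobian `H = ∇_p z_π(p)`. -/
noncomputable def jacobian (M : Market 𝒢 J) (Θ : Measure 𝒢) (π : ℝ) (p : Price J) :
    Price J →L[ℝ] Price J :=
  fderiv ℝ (M.meanExcess Θ π) p

/-- The second-moment matrix `E[Z(W, p) Z(W, p)ᵀ]`, where the treatment `W` is drawn with
probability `π` independently of the individual. -/
noncomputable def secondMoment (M : Market 𝒢 J) (Θ : Measure 𝒢) (π : ℝ) (p : Price J) :
    Matrix (Fin J) (Fin J) ℝ :=
  Matrix.of fun j k =>
    π * ∫ g, M.excess g true p j * M.excess g true p k ∂Θ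
      + (1 - π) * ∫ g, M.excess g false p j * M.excess g false p k ∂Θ

/-- Choke prices. Excess demand for a good is nonpositive whenever the price of that good is at
least `u j`, and nonnegative whenever it is at most `l j`; in each case the inequality is strict
for a set of types of positive measure. -/
structure PricesBounded (M : Market 𝒢 J) (Θ : Measure 𝒢) (l u : Price J) : Prop where
  lower_pos : ∀ j, 0 < l j
  upper_pos : ∀ j, 0 < u j
  upper : ∀ g w j (p : Price J), u j ≤ p j → M.excess g w p j ≤ 0
  lower : ∀ g w j (p : Price J), p j ≤ l j → 0 ≤ M.excess g w p j
  upper_strict : ∀ w j, ∃ A : Set 𝒢, MeasurableSet A ∧ 0 < Θ A ∧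
    ∀ g ∈ A, ∀ p : Price J, u j ≤ p j → M.excess g w p j < 0
  lower_strict : ∀ w j, ∃ A : Set 𝒢, MeasurableSet A ∧ 0 < Θ A ∧
    ∀ g ∈ A, ∀ p : Price J, p j ≤ l j → 0 < M.excess g w p j

/-- Outcome, demand and supply functions are twice continuously differentiable on a neighbourhood
of the price box, with bounds on the derivatives of order at most two that are uniform over the
types. -/
def Smooth (M : Market 𝒢 J) (l u : Price J) : Prop :=
  ∃ δ > 0, ∃ C : ℝ, ∀ g w,
    SmoothBoundedOn (M.outcome g w) (priceBox l u δ) C ∧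
    SmoothBoundedOn (M.demand g w) (priceBox l u δ) C ∧
    SmoothBoundedOn (M.supply g w) (priceBox l u δ) C

/-- Conditions on the mean-field market: the Jacobian of the excess demand has full rank at the
mean-field price, `p ↦ z_π(p) + p` has a Jacobian of operator norm less than one on the box, and
the second-moment matrix of the excess demand has full rank at the mean-field price. -/
structure MeanFieldRegular (M : Market 𝒢 J) (Θ : Measure 𝒢) (π : ℝ) (l u : Price J) : Prop where
  jacobian_invertible : ∀ p, M.IsMeanFieldPrice Θ π l u p → (M.jacobian Θ π p).IsInvertible
  contraction : ∀ p ∈ priceBox l u 0, ‖fderiv ℝ (fun q => M.meanExcess Θ π q + q) p‖ < 1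
  secondMoment_invertible : ∀ p, M.IsMeanFieldPrice Θ π l u p → IsUnit (M.secondMoment Θ π p)

/-- Approximate clearing in finite samples: at rate `a n = o(1/n)`, for every matrix of
perturbations bounded by `B`, also when one individual `k` has its treatment fixed at `w`. -/
def ApproxClears (M : Market 𝒢 J) {Ω : Type*} [MeasurableSpace Ω] (μ : Measure Ω)
    (g : ℕ → Ω → 𝒢) (W : ℕ → Ω → Bool) (B : ℝ) : Prop :=
  ∃ a : ℕ → ℝ, Tendsto (fun n : ℕ => (n : ℝ) * a n) atTop (𝓝 0) ∧
    ∀ᵐ ω ∂μ, ∀ᶠ n : ℕ in atTop, ∀ V : Fin n → Price J, (∀ i j, |V i j| ≤ B) →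
      ∀ (k : Fin n) (w : Bool), ∃ p : Price J,
        ‖M.avgExcess (fun i => g i ω) (Function.update (fun i : Fin n => W i ω) k w) V p‖ ≤ a n

/-- The sampling and the augmented experiment with perturbation sizes `h n`: for every `n`, the
types, treatments and perturbations of the individuals `0, …, n - 1` are i.i.d. across
individuals, and for each individual the type (drawn from `Θ`), the treatment (Bernoulli with
probability `π`) and the `J` perturbations (uniform on `{-h n, h n}`) are independent. -/
def IsExperiment {Ω : Type*} [MeasurableSpace Ω] (J : ℕ) (μ : Measure Ω) (Θ : Measure 𝒢) (π : ℝ)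
    (h : ℕ → ℝ) (g : ℕ → Ω → 𝒢) (W : ℕ → Ω → Bool) (U : (n : ℕ) → Fin n → Ω → Price J) : Prop :=
  ∀ n : ℕ, HasLaw (fun ω (i : Fin n) => (g i ω, W i ω, U n i ω))
    (Measure.pi fun _ : Fin n => Θ.prod ((treatmentLaw π).prod (perturbationLaw J (h n)))) μ

/-- The Horvitz–Thompson estimator of the average direct effect, computed from the realized
outcomes `Yᵢ = Yᵢ(Wᵢ, P + Uᵢ)`. -/
noncomputable def adeEstimator (M : Market 𝒢 J) (π : ℝ) {n : ℕ} (g : Fin n → 𝒢)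
    (W : Fin n → Bool) (U : Fin n → Price J) (P : Price J) : ℝ :=
  (n : ℝ)⁻¹ * ∑ i, ((if W i then 1 else 0) * M.outcome (g i) (W i) (P + U i) / π
    - (1 - (if W i then 1 else 0)) * M.outcome (g i) (W i) (P + U i) / (1 - π))

/-- The mean-field direct effect `y(1, p) - y(0, p)`. -/
noncomputable def adeLimit (M : Market 𝒢 J) (Θ : Measure 𝒢) (p : Price J) : ℝ :=
  M.meanOutcome Θ true p - M.meanOutcome Θ false p

/-- The linear functional `v ↦ aᵀ H⁻¹ v`, where `a` is the gradient of `y(1, ·) - y(0, ·)` at `p`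
and `H` is the Jacobian of the mean-field excess demand at `p`. -/
noncomputable def priceCorrection (M : Market 𝒢 J) (Θ : Measure 𝒢) (π : ℝ) (p : Price J) :
    Price J →L[ℝ] ℝ :=
  (fderiv ℝ (M.adeLimit Θ) p).comp (M.jacobian Θ π p).inverse

/-- `R_i`, as a function of the type. -/
noncomputable def varR (M : Market 𝒢 J) (Θ : Measure 𝒢) (π : ℝ) (p : Price J) (g : 𝒢) : ℝ :=
  M.outcome g true p / π + M.outcome g false p / (1 - π)
    - M.priceCorrection Θ π p (M.excess g true p - M.excess g false p)

/-- `T_i`, as a function of the type. -/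
noncomputable def varT (M : Market 𝒢 J) (Θ : Measure 𝒢) (π : ℝ) (p : Price J) (g : 𝒢) : ℝ :=
  M.outcome g true p - M.outcome g false p
    - M.priceCorrection Θ π p (π • M.excess g true p + (1 - π) • M.excess g false p)

/-- The asymptotic variance `σ_D² = π (1 - π) E[R_i²] + Var[T_i]`. -/
noncomputable def sigmaSqD (M : Market 𝒢 J) (Θ : Measure 𝒢) (π : ℝ) (p : Price J) : ℝ :=
  π * (1 - π) * (∫ g, M.varR Θ π p g ^ 2 ∂Θ) + variance (M.varT Θ π p) Θ

end Market

/-! The market price is an implicit estimator, and the argument is a delta method for it. Let `x` be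
the pair (type, treatment), `Z` the excess demand and `F` the outcome weighted by `1/π` on the
treated and by `-1/(1-π)` on the controls. Then `E Z(x,p) = z_π(p)` and `E F(x,p) = y(1,p) - y(0,p)`
on the box, and the estimator is the sample average of `F(xᵢ, P + Uᵢ)`.

Exact clearing: by compactness the Jacobian of `z_π + id` has norm at most some `K < 1` on the box.
The law of large numbers on a finite net, with the uniform Lipschitz bound on derivatives, transfers
this to the perturbed sample average (`exists_ae_eventually_contraction`). A contraction followed by
projection onto the box has a fixed point, and the choke-price signs on the faces make it a zero of
excess demand (`exists_zero_of_contraction`). On the mean field this gives `p*`. In the sample it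
shows that the minimal norm is `0`, and types with strict inequalities confine every zero to the
enlarged box (`IsClearingPrice.mem_priceBox_and_eq_zero`).

Linearization: with `Δ = P - p*`, Taylor expansion at `p*` gives `0 = S + A Δ + Q + ρ` for demand,
and the estimator minus the average of `F(xᵢ, p*)` equals `A' Δ + Q' + ρ'`. Here `S` is the average
excess demand at `p*`, `A` and `A'` are average derivatives, `Q` and `Q'` are linear in the
perturbations, and `ρ`, `ρ'` are of order `‖Δ‖² + h²`. The perturbations are centred and independent
of `x`, so `√n Q` and `√n Q'` have variance of order `h²`; also `√n h² → 0` because `α > 1/4`. The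
contraction bounds `‖Δ‖` by a multiple of `‖S‖ + ‖Q‖ + h²`. Eliminating `Δ` leaves the average of `F
- aᵀH⁻¹Z` at `p*` up to `o_p(n^{-1/2})` (`tendstoInMeasure_adeEstimator_sub_average_influence`).

The central limit theorem and Slutsky's lemma conclude. The law of total variance over the treatment
turns the variance of `F - aᵀH⁻¹Z` into the expression in `R` and `T` (`sigmaSqD_eq_variance`). -/

/-! ### Price boxes and zeros of contractions on them -/

section PriceBox

variable {J : ℕ} {l u : Price J} {δ δ' : ℝ}

lemma convex_priceBox : Convex ℝ (priceBox l u δ) := by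
  intro p hp q hq a b ha hb hab j
  obtain ⟨h1, h2⟩ := hp j
  obtain ⟨h3, h4⟩ := hq j
  simp only [PiLp.add_apply, PiLp.smul_apply, smul_eq_mul]
  constructor
  · calc l j - δ = a * (l j - δ) + b * (l j - δ) := by rw [← add_mul, hab, one_mul]
      _ ≤ _ := by gcongr
  · calc a * p j + b * q j ≤ a * (u j + δ) + b * (u j + δ) := by gcongr
      _ = u j + δ := by rw [← add_mul, hab, one_mul]

lemma priceBox_mono (h : δ ≤ δ') : priceBox l u δ ⊆ priceBox l u δ' := fun _ hp j =>
  ⟨by linarith [(hp j).1], by linarith [(hp j).2]⟩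

lemma add_mem_priceBox {p v : Price J} (hp : p ∈ priceBox l u δ) (hv : ∀ j, |v j| ≤ δ') :
    p + v ∈ priceBox l u (δ + δ') := by
  intro j
  have := abs_le.1 (hv j)
  have := hp j
  simp only [PiLp.add_apply]
  constructor <;> linarith

lemma isClosed_priceBox : IsClosed (priceBox l u δ) := by
  have : priceBox l u δ = ⋂ j, {p : Price J | l j - δ ≤ p j ∧ p j ≤ u j + δ} := by
    ext p; simp [priceBox]
  rw [this]
  refine isClosed_iInter fun j => IsClosed.and ?_ ?_
  · exact isClosed_le continuous_const (by fun_prop)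
  · exact isClosed_le (by fun_prop) continuous_const

lemma isCompact_priceBox : IsCompact (priceBox l u δ) := by
  have hK : IsCompact (Set.univ.pi fun j => Set.Icc (l j - δ) (u j + δ)) :=
    isCompact_univ_pi fun j => isCompact_Icc
  have := hK.image (PiLp.continuous_toLp 2 (fun _ : Fin J => ℝ))
  refine this.of_isClosed_subset isClosed_priceBox fun p hp => ⟨fun j => p j, ?_, rfl⟩
  intro j _
  exact hp j

lemma ball_subset_priceBox {p : Price J} (hp : p ∈ priceBox l u δ) (r : ℝ) :
    Metric.ball p r ⊆ priceBox l u (δ + r) := by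
  intro q hq
  have : q = p + (q - p) := by abel
  rw [this]
  refine add_mem_priceBox hp fun j => ?_
  have h := PiLp.norm_apply_le (q - p) j
  rw [Real.norm_eq_abs] at h
  exact h.trans (by rw [← dist_eq_norm]; exact (Metric.mem_ball.1 hq).le)

lemma priceBox_mem_nhds {p : Price J} (hp : p ∈ priceBox l u δ) (h : δ < δ') :
    priceBox l u δ' ∈ 𝓝 p := by
  refine mem_of_superset (Metric.ball_mem_nhds p (sub_pos.2 h)) ?_
  simpa using ball_subset_priceBox hp (δ' - δ)

/-- The nearest point of the box. -/
noncomputable def boxClamp (l u : Price J) (δ : ℝ) (p : Price J) : Price J :=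
  WithLp.toLp 2 fun j => max (l j - δ) (min (p j) (u j + δ))

@[simp] lemma boxClamp_apply (p : Price J) (j : Fin J) :
    boxClamp l u δ p j = max (l j - δ) (min (p j) (u j + δ)) := rfl

lemma boxClamp_mem (h : ∀ j, l j - δ ≤ u j + δ) (p : Price J) :
    boxClamp l u δ p ∈ priceBox l u δ := fun j =>
  ⟨le_max_left _ _, max_le (h j) (min_le_right _ _)⟩

lemma norm_le_of_abs_apply_le {v w : Price J} (h : ∀ j, |v j| ≤ |w j|) : ‖v‖ ≤ ‖w‖ := by
  rw [EuclideanSpace.norm_eq, EuclideanSpace.norm_eq]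
  gcongr with j
  exact h j

/-- Truncation to an interval is 1-Lipschitz in each coordinate, so clamping after a contraction
keeps it a contraction. -/
lemma norm_boxClamp_sub_le (p q : Price J) :
    ‖boxClamp l u δ p - boxClamp l u δ q‖ ≤ ‖p - q‖ := by
  refine norm_le_of_abs_apply_le fun j => ?_
  simp only [PiLp.sub_apply, boxClamp_apply]
  refine (abs_max_sub_max_le_max _ _ _ _).trans ?_
  rw [sub_self, abs_zero]
  refine max_le (abs_nonneg _) ((abs_min_sub_min_le_max _ _ _ _).trans ?_)
  simp

/-- If `p ↦ f p + p` is a contraction on a box, and `f` points into the box on its faces, then `f`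
has a zero in the box. -/
lemma exists_zero_of_contraction (hlu : ∀ j, l j - δ ≤ u j + δ) {f : Price J → Price J} {K : ℝ}
    (hK : K < 1)
    (hf : ∀ p ∈ priceBox l u δ, ∀ q ∈ priceBox l u δ, ‖(f p + p) - (f q + q)‖ ≤ K * ‖p - q‖)
    (hup : ∀ p ∈ priceBox l u δ, ∀ j, p j = u j + δ → f p j ≤ 0)
    (hlow : ∀ p ∈ priceBox l u δ, ∀ j, p j = l j - δ → 0 ≤ f p j) :
    ∃ p ∈ priceBox l u δ, f p = 0 := by
  set T : Price J → Price J := fun p => boxClamp l u δ (f p + p) with hT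
  have hmaps : Set.MapsTo T (priceBox l u δ) (priceBox l u δ) := fun p _ => boxClamp_mem hlu _
  have hcontr : ContractingWith K.toNNReal hmaps.restrict := by
    refine ⟨Real.toNNReal_lt_one.2 hK, LipschitzWith.of_dist_le_mul fun p q => ?_⟩
    rw [Subtype.dist_eq, Subtype.dist_eq, dist_eq_norm, dist_eq_norm]
    calc ‖T p - T q‖ ≤ ‖(f p + p) - (f q + q)‖ := norm_boxClamp_sub_le _ _
      _ ≤ K * ‖(p : Price J) - q‖ := hf _ p.2 _ q.2
      _ ≤ _ := by gcongr; exact Real.le_coe_toNNReal K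
  obtain ⟨p, hp, hfix, -⟩ := hcontr.exists_fixedPoint' isClosed_priceBox.isComplete hmaps
    (boxClamp_mem hlu 0) (edist_ne_top _ _)
  refine ⟨p, hp, ?_⟩
  ext j
  have hj : max (l j - δ) (min (f p j + p j) (u j + δ)) = p j := by
    have := congrArg (fun v : Price J => v j) hfix
    simpa [hT] using this
  have h1 := hup p hp j
  have h2 := hlow p hp j
  have h3 := hp j
  simp only [PiLp.zero_apply]
  -- A coordinate with `f p j < 0` is not on the lower face, so the clamped map would strictly
  -- decrease it, contradicting the fixed point; the positive case is symmetric.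
  rcases lt_trichotomy (f p j) 0 with h | h | h
  · have : p j ≠ l j - δ := fun e => absurd (h2 e) (not_le.2 h)
    have h4 : l j - δ < p j := lt_of_le_of_ne h3.1 this.symm
    have : max (l j - δ) (min (f p j + p j) (u j + δ)) < p j :=
      max_lt h4 ((min_le_left _ _).trans_lt (by linarith))
    exact absurd hj this.ne
  · exact h
  · have : p j ≠ u j + δ := fun e => absurd (h1 e) (not_le.2 h)
    have h4 : p j < u j + δ := lt_of_le_of_ne h3.2 this
    have : p j < max (l j - δ) (min (f p j + p j) (u j + δ)) :=
      lt_max_of_lt_right (lt_min (by linarith) h4)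
    exact absurd hj this.ne'

/-- If `p ↦ f p + p` is a `K`-contraction, distances to a zero of `f` are controlled by `f`. -/
lemma norm_sub_le_of_contraction {s : Set (Price J)} {f : Price J → Price J} {K : ℝ}
    (hf : ∀ p ∈ s, ∀ q ∈ s, ‖(f p + p) - (f q + q)‖ ≤ K * ‖p - q‖)
    {p q : Price J} (hp : p ∈ s) (hq : q ∈ s) : (1 - K) * ‖p - q‖ ≤ ‖f p - f q‖ := by
  have h := hf p hp q hq
  have : p - q = ((f p + p) - (f q + q)) - (f p - f q) := by abel
  have h2 : ‖p - q‖ ≤ ‖(f p + p) - (f q + q)‖ + ‖f p - f q‖ := by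
    conv_lhs => rw [this]
    exact norm_sub_le _ _
  linarith

lemma norm_le_sqrt_mul_of_abs_le {v : Price J} {r : ℝ} (hr : 0 ≤ r) (hv : ∀ j, |v j| ≤ r) :
    ‖v‖ ≤ √J * r := by
  rw [EuclideanSpace.norm_eq]
  calc √(∑ j, ‖v j‖ ^ 2) ≤ √(∑ _j : Fin J, r ^ 2) := by
        gcongr with j
        exact hv j
    _ = √J * r := by simp [Real.sqrt_sq hr]

end PriceBox

/-! ### Families of functions with uniform derivative bounds -/

/-- A family of functions of the price vector, indexed by a measurable space, that is uniformly
bounded on `s`, with uniformly bounded and uniformly Lipschitz derivatives. -/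
structure SmoothFamily {X E : Type*} [MeasurableSpace X] {J : ℕ} [NormedAddCommGroup E]
    [NormedSpace ℝ E] [MeasurableSpace E] (G : X → Price J → E) (s : Set (Price J)) (C : ℝ) :
    Prop where
  measurable : ∀ p, Measurable fun x => G x p
  differentiableAt : ∀ x, ∀ p ∈ s, DifferentiableAt ℝ (G x) p
  norm_le : ∀ x, ∀ p ∈ s, ‖G x p‖ ≤ C
  norm_fderiv_le : ∀ x, ∀ p ∈ s, ‖fderiv ℝ (G x) p‖ ≤ C
  norm_fderiv_sub_le : ∀ x, ∀ p ∈ s, ∀ q ∈ s,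
    ‖fderiv ℝ (G x) p - fderiv ℝ (G x) q‖ ≤ C * ‖p - q‖

section SmoothBoundedOn

variable {J : ℕ} {F : Type*} [NormedAddCommGroup F] [NormedSpace ℝ F] {f : Price J → F}
  {s : Set (Price J)} {C : ℝ}

/-- Mean value inequality for the first derivative. The second-order bound enters the proof only in
this Lipschitz form. -/
lemma SmoothBoundedOn.norm_fderiv_sub_le (h : SmoothBoundedOn f s C) (hs : Convex ℝ s)
    {p q : Price J} (hp : p ∈ s) (hq : q ∈ s) :
    ‖fderiv ℝ f p - fderiv ℝ f q‖ ≤ C * ‖p - q‖ := by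
  refine hs.norm_image_sub_le_of_norm_fderiv_le (𝕜 := ℝ) (fun x hx => ?_) (fun x hx => ?_) hq hp
  · exact ((h x hx).1.fderiv_right (m := 1) (by norm_num)).differentiableAt (by norm_num)
  · rw [← norm_iteratedFDeriv_one, norm_iteratedFDeriv_fderiv]
    exact (h x hx).2 2 le_rfl

lemma SmoothBoundedOn.differentiableAt (h : SmoothBoundedOn f s C) {p : Price J} (hp : p ∈ s) :
    DifferentiableAt ℝ f p := (h p hp).1.differentiableAt (by norm_num)

lemma SmoothBoundedOn.norm_le (h : SmoothBoundedOn f s C) {p : Price J} (hp : p ∈ s) :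
    ‖f p‖ ≤ C := by simpa using (h p hp).2 0 (by norm_num)

lemma SmoothBoundedOn.norm_fderiv_le (h : SmoothBoundedOn f s C) {p : Price J} (hp : p ∈ s) :
    ‖fderiv ℝ f p‖ ≤ C := by
  simpa [norm_iteratedFDeriv_one] using (h p hp).2 1 (by norm_num)

end SmoothBoundedOn

namespace SmoothFamily

variable {X E : Type*} [MeasurableSpace X] {J : ℕ} [NormedAddCommGroup E]
    [NormedSpace ℝ E] [MeasurableSpace E] {G G' : X → Price J → E} {s t : Set (Price J)} {C C' : ℝ}

lemma of_smoothBoundedOn (hm : ∀ p, Measurable fun x => G x p) (hs : Convex ℝ s)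
    (h : ∀ x, SmoothBoundedOn (G x) s C) : SmoothFamily G s C where
  measurable := hm
  differentiableAt x _ hp := (h x).differentiableAt hp
  norm_le x _ hp := (h x).norm_le hp
  norm_fderiv_le x _ hp := (h x).norm_fderiv_le hp
  norm_fderiv_sub_le x _ hp _ hq := (h x).norm_fderiv_sub_le hs hp hq

lemma sub [BorelSpace E] [SecondCountableTopology E] (h : SmoothFamily G s C)
    (h' : SmoothFamily G' s C') : SmoothFamily (fun x p => G x p - G' x p) s (C + C') where
  measurable p := (h.measurable p).sub (h'.measurable p)
  differentiableAt x p hp := (h.differentiableAt x p hp).sub (h'.differentiableAt x p hp)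
  norm_le x p hp := (norm_sub_le _ _).trans (add_le_add (h.norm_le x p hp) (h'.norm_le x p hp))
  norm_fderiv_le x p hp := by
    rw [fderiv_fun_sub (h.differentiableAt x p hp) (h'.differentiableAt x p hp)]
    exact (norm_sub_le _ _).trans (add_le_add (h.norm_fderiv_le x p hp) (h'.norm_fderiv_le x p hp))
  norm_fderiv_sub_le x p hp q hq := by
    rw [fderiv_fun_sub (h.differentiableAt x p hp) (h'.differentiableAt x p hp),
      fderiv_fun_sub (h.differentiableAt x q hq) (h'.differentiableAt x q hq),
      sub_sub_sub_comm, add_mul]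
    exact (norm_sub_le _ _).trans
      (add_le_add (h.norm_fderiv_sub_le x p hp q hq) (h'.norm_fderiv_sub_le x p hp q hq))

lemma smul [BorelSpace E] [SecondCountableTopology E] (h : SmoothFamily G s C) {c : X → ℝ}
    (hc : Measurable c) {b : ℝ} (hb : ∀ x, |c x| ≤ b) :
    SmoothFamily (fun x p => c x • G x p) s (b * C) where
  measurable p := hc.smul (h.measurable p)
  differentiableAt x p hp := (h.differentiableAt x p hp).const_smul _
  norm_le x p hp := by
    rw [norm_smul, Real.norm_eq_abs]
    exact mul_le_mul (hb x) (h.norm_le x p hp) (norm_nonneg _) ((abs_nonneg _).trans (hb x))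
  norm_fderiv_le x p hp := by
    rw [fderiv_fun_const_smul (h.differentiableAt x p hp), norm_smul, Real.norm_eq_abs]
    exact mul_le_mul (hb x) (h.norm_fderiv_le x p hp) (norm_nonneg _) ((abs_nonneg _).trans (hb x))
  norm_fderiv_sub_le x p hp q hq := by
    rw [fderiv_fun_const_smul (h.differentiableAt x p hp),
      fderiv_fun_const_smul (h.differentiableAt x q hq), ← smul_sub, norm_smul, Real.norm_eq_abs,
      mul_assoc]
    exact mul_le_mul (hb x) (h.norm_fderiv_sub_le x p hp q hq) (norm_nonneg _)
      ((abs_nonneg _).trans (hb x))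

/-- Along the segment the derivative differs from its value at `p` by at most `C * ‖q - p‖`. This
crude bound costs a factor 2 against the sharp constant, which is immaterial. -/
lemma norm_taylor_le (h : SmoothFamily G s C) (hs : Convex ℝ s) (hC : 0 ≤ C) (x : X)
    {p q : Price J} (hp : p ∈ s) (hq : q ∈ s) :
    ‖G x q - G x p - fderiv ℝ (G x) p (q - p)‖ ≤ C * ‖q - p‖ ^ 2 := by
  have hseg : segment ℝ p q ⊆ s := hs.segment_subset hp hq
  have := (convex_segment p q).norm_image_sub_le_of_norm_hasFDerivWithin_le' (𝕜 := ℝ)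
    (f := G x) (f' := fderiv ℝ (G x)) (φ := fderiv ℝ (G x) p) (C := C * ‖q - p‖)
    (fun y hy => (h.differentiableAt x y (hseg hy)).hasFDerivAt.hasFDerivWithinAt)
    (fun y hy => ?_) (left_mem_segment ℝ p q) (right_mem_segment ℝ p q)
  · rw [pow_two, ← mul_assoc]; exact this
  · refine (h.norm_fderiv_sub_le x y (hseg hy) p hp).trans ?_
    gcongr
    obtain ⟨θ, hθ, rfl⟩ := (segment_eq_image' ℝ p q) ▸ hy
    rw [add_sub_cancel_left, norm_smul, Real.norm_of_nonneg hθ.1]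
    exact mul_le_of_le_one_left (norm_nonneg _) hθ.2

end SmoothFamily

section

variable {J : ℕ} {E : Type*} [NormedAddCommGroup E] [NormedSpace ℝ E]

lemma clm_apply_eq_sum (L : Price J →L[ℝ] E) (v : Price J) :
    L v = ∑ j, v j • L (EuclideanSpace.single j 1) := by
  conv_lhs => rw [← (EuclideanSpace.basisFun (Fin J) ℝ).sum_repr v, map_sum]
  simp

lemma clm_eq_sum_smulRight (L : Price J →L[ℝ] E) :
    L = ∑ j, (EuclideanSpace.proj j : Price J →L[ℝ] ℝ).smulRight
      (L (EuclideanSpace.single j 1)) := by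
  refine ContinuousLinearMap.ext fun v => ?_
  rw [clm_apply_eq_sum]
  simp

end

namespace SmoothFamily

variable {X E : Type*} [MeasurableSpace X] {J : ℕ} [NormedAddCommGroup E]
    [NormedSpace ℝ E] [MeasurableSpace E] [BorelSpace E] [SecondCountableTopology E]
    {G : X → Price J → E} {s : Set (Price J)} {C : ℝ} {ν : Measure X}

/-- A directional derivative is the pointwise limit of difference quotients with step `1/k`, each
measurable in the index. -/
lemma measurable_fderiv_apply (h : SmoothFamily G s C) {p : Price J} (hp : p ∈ s)
    (v : Price J) : Measurable fun x => fderiv ℝ (G x) p v := by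
  refine measurable_of_tendsto_metrizable
    (f := fun (k : ℕ) x => (k : ℝ) • (G x (p + (k : ℝ)⁻¹ • v) - G x p)) (fun k => ?_) ?_
  · exact ((h.measurable _).sub (h.measurable _)).const_smul _
  · rw [tendsto_pi_nhds]
    intro x
    refine (h.differentiableAt x p hp).hasFDerivAt.lim v ?_
    simpa using tendsto_natCast_atTop_atTop (R := ℝ)

lemma measurable_fderiv [FiniteDimensional ℝ E] (h : SmoothFamily G s C) {p : Price J}
    (hp : p ∈ s) : Measurable fun x => fderiv ℝ (G x) p := by
  have : (fun x => fderiv ℝ (G x) p) = fun x =>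
      ∑ j, (EuclideanSpace.proj j : Price J →L[ℝ] ℝ).smulRight
        (fderiv ℝ (G x) p (EuclideanSpace.single j 1)) :=
    funext fun x => clm_eq_sum_smulRight _
  rw [this]
  refine Finset.measurable_fun_sum _ fun j _ => ?_
  have hc : Continuous fun y : E => (EuclideanSpace.proj j : Price J →L[ℝ] ℝ).smulRight y :=
    (ContinuousLinearMap.smulRightL ℝ (Price J) E (EuclideanSpace.proj j)).continuous
  exact hc.measurable.comp (h.measurable_fderiv_apply hp _)

lemma integrable [IsFiniteMeasure ν] (h : SmoothFamily G s C) {p : Price J} (hp : p ∈ s) :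
    Integrable (fun x => G x p) ν :=
  .of_bound (h.measurable p).aestronglyMeasurable C (ae_of_all _ fun x => h.norm_le x p hp)

lemma integrable_fderiv [FiniteDimensional ℝ E] [IsFiniteMeasure ν] (h : SmoothFamily G s C)
    {p : Price J} (hp : p ∈ s) : Integrable (fun x => fderiv ℝ (G x) p) ν :=
  .of_bound (h.measurable_fderiv hp).aestronglyMeasurable C
    (ae_of_all _ fun x => h.norm_fderiv_le x p hp)

/-- Differentiation under the integral, dominated by the constant `C`, which is integrable for a
finite measure. -/
lemma hasFDerivAt_integral [FiniteDimensional ℝ E] [IsFiniteMeasure ν] (h : SmoothFamily G s C)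
    {p : Price J} (hp : s ∈ 𝓝 p) :
    HasFDerivAt (fun q => ∫ x, G x q ∂ν) (∫ x, fderiv ℝ (G x) p ∂ν) p := by
  refine hasFDerivAt_integral_of_dominated_of_fderiv_le (bound := fun _ => C) hp
    (Eventually.of_forall fun q => (h.measurable q).aestronglyMeasurable)
    (h.integrable (mem_of_mem_nhds hp))
    (h.measurable_fderiv (mem_of_mem_nhds hp)).aestronglyMeasurable
    (ae_of_all _ fun x q hq => h.norm_fderiv_le x q hq) (integrable_const _)
    (ae_of_all _ fun x q hq => (h.differentiableAt x q hq).hasFDerivAt)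

lemma norm_integral_fderiv_sub_le [FiniteDimensional ℝ E] [IsProbabilityMeasure ν]
    (h : SmoothFamily G s C) {p q : Price J} (hp : p ∈ s) (hq : q ∈ s) :
    ‖∫ x, fderiv ℝ (G x) p ∂ν - ∫ x, fderiv ℝ (G x) q ∂ν‖ ≤ C * ‖p - q‖ := by
  rw [← integral_sub (h.integrable_fderiv hp) (h.integrable_fderiv hq)]
  refine (norm_integral_le_of_norm_le_const (C := C * ‖p - q‖)
    (ae_of_all _ fun x => h.norm_fderiv_sub_le x p hp q hq)).trans ?_
  simp

end SmoothFamily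

/-! ### Moments of the treatment and perturbation laws -/

section Laws

variable {𝒢 : Type*} [MeasurableSpace 𝒢] {Θ : Measure 𝒢} [IsProbabilityMeasure Θ] {J : ℕ} {π : ℝ}

lemma isProbabilityMeasure_treatmentLaw (h₀ : 0 ≤ π) (h₁ : π ≤ 1) :
    IsProbabilityMeasure (treatmentLaw π) := by
  constructor
  simp [treatmentLaw, ← ENNReal.ofReal_add h₀ (sub_nonneg.2 h₁)]

instance isProbabilityMeasure_signLaw (h : ℝ) : IsProbabilityMeasure (signLaw h) := by
  constructor
  simp [signLaw, ENNReal.inv_two_add_inv_two]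

instance isProbabilityMeasure_perturbationLaw (h : ℝ) :
    IsProbabilityMeasure (perturbationLaw J h) :=
  Measure.isProbabilityMeasure_map (WithLp.measurable_toLp 2 _).aemeasurable

lemma integral_treatmentLaw {E : Type*} [NormedAddCommGroup E] [NormedSpace ℝ E]
    [CompleteSpace E] (h₀ : 0 ≤ π) (h₁ : π ≤ 1) (f : Bool → E) :
    ∫ w, f w ∂treatmentLaw π = π • f true + (1 - π) • f false := by
  have hi : ∀ b, Integrable f (Measure.dirac b) := fun b => Integrable.of_finite
  rw [treatmentLaw, integral_add_measure ((hi _).smul_measure ENNReal.ofReal_ne_top)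
    ((hi _).smul_measure ENNReal.ofReal_ne_top), integral_smul_measure, integral_smul_measure,
    integral_dirac, integral_dirac, ENNReal.toReal_ofReal h₀,
    ENNReal.toReal_ofReal (sub_nonneg.2 h₁)]

lemma integral_prod_treatmentLaw {E : Type*} [NormedAddCommGroup E] [NormedSpace ℝ E]
    [CompleteSpace E] (h₀ : 0 ≤ π) (h₁ : π ≤ 1) {f : 𝒢 × Bool → E}
    (hf : Integrable f (Θ.prod (treatmentLaw π)))
    (ht : Integrable (fun g => f (g, true)) Θ) (hc : Integrable (fun g => f (g, false)) Θ) :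
    ∫ x, f x ∂Θ.prod (treatmentLaw π) =
      π • ∫ g, f (g, true) ∂Θ + (1 - π) • ∫ g, f (g, false) ∂Θ := by
  have := isProbabilityMeasure_treatmentLaw h₀ h₁
  rw [integral_prod _ hf]
  simp_rw [integral_treatmentLaw h₀ h₁]
  rw [integral_add (f := fun g => π • f (g, true)) (g := fun g => (1 - π) • f (g, false))
    (ht.smul _) (hc.smul _), integral_smul,
    integral_smul]

/-- Law of total variance for a function of the type and of the treatment. -/
lemma variance_prod_treatmentLaw (h₀ : 0 ≤ π) (h₁ : π ≤ 1) {f : 𝒢 × Bool → ℝ}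
    (hf : Measurable f) {C : ℝ} (hC : ∀ x, |f x| ≤ C) :
    variance f (Θ.prod (treatmentLaw π)) =
      π * (1 - π) * ∫ g, (f (g, true) - f (g, false)) ^ 2 ∂Θ
        + variance (fun g => π * f (g, true) + (1 - π) * f (g, false)) Θ := by
  have := isProbabilityMeasure_treatmentLaw h₀ h₁
  have m : ∀ w, Measurable fun g => f (g, w) := fun w => by fun_prop
  have hC0 : ∀ x, |f x| ≤ |C| := fun x => (hC x).trans (le_abs_self C)
  have i1 : ∀ w, Integrable (fun g => f (g, w)) Θ := fun w =>
    .of_bound (m w).aestronglyMeasurable C (ae_of_all _ fun x => hC _)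
  have i2 : ∀ w w', Integrable (fun g => f (g, w) * f (g, w')) Θ := fun w w' =>
    .of_bound ((m w).mul (m w')).aestronglyMeasurable (|C| * |C|) (ae_of_all _ fun x => by
      rw [norm_mul]; exact mul_le_mul (hC0 _) (hC0 _) (norm_nonneg _) (abs_nonneg _))
  have j1 : MemLp f 2 (Θ.prod (treatmentLaw π)) :=
    .of_bound hf.aestronglyMeasurable C (ae_of_all _ fun x => hC _)
  have j2 : MemLp (fun g => π * f (g, true) + (1 - π) * f (g, false)) 2 Θ :=
    .of_bound (by fun_prop) (π * C + (1 - π) * C) (ae_of_all _ fun x => by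
      refine (norm_add_le _ _).trans ?_
      rw [norm_mul, norm_mul, Real.norm_of_nonneg h₀, Real.norm_of_nonneg (sub_nonneg.2 h₁)]
      have := sub_nonneg.2 h₁
      gcongr <;> exact hC _)
  have k1 : ∀ a : ℝ, Integrable
      (fun g => f (g, true) * f (g, true) - a * (f (g, true) * f (g, false))) Θ :=
    fun a => (i2 _ _).sub ((i2 _ _).const_mul a)
  have k2 : ∀ a b : ℝ, Integrable
      (fun g => a * (f (g, true) * f (g, true)) + b * (f (g, true) * f (g, false))) Θ :=
    fun a b => ((i2 _ _).const_mul a).add ((i2 _ _).const_mul b)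
  -- Both variances are expanded into first and second moments over the types; the identity is then
  -- polynomial in these moments.
  rw [variance_eq_sub j1, variance_eq_sub j2]
  have e1 : ∫ x, (f ^ 2) x ∂Θ.prod (treatmentLaw π) =
      π * ∫ g, f (g, true) * f (g, true) ∂Θ + (1 - π) * ∫ g, f (g, false) * f (g, false) ∂Θ := by
    rw [integral_prod_treatmentLaw (f := f ^ 2) h₀ h₁ j1.integrable_sq]
    · simp [pow_two]
    · simpa [pow_two] using i2 true true
    · simpa [pow_two] using i2 false false
  have e2 := integral_prod_treatmentLaw h₀ h₁ (j1.integrable (by norm_num)) (i1 true) (i1 false)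
  have e3 : ∫ g, (f (g, true) - f (g, false)) ^ 2 ∂Θ = ∫ g, f (g, true) * f (g, true) ∂Θ
      - 2 * ∫ g, f (g, true) * f (g, false) ∂Θ + ∫ g, f (g, false) * f (g, false) ∂Θ := by
    rw [← integral_const_mul, ← integral_sub (i2 _ _) ((i2 _ _).const_mul _),
      ← integral_add (k1 2) (i2 _ _)]
    congr 1 with x; ring
  have e4 : ∫ g, ((fun g => π * f (g, true) + (1 - π) * f (g, false)) ^ 2) g ∂Θ =
      π ^ 2 * ∫ g, f (g, true) * f (g, true) ∂Θ
      + 2 * π * (1 - π) * ∫ g, f (g, true) * f (g, false) ∂Θ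
      + (1 - π) ^ 2 * ∫ g, f (g, false) * f (g, false) ∂Θ := by
    rw [← integral_const_mul, ← integral_const_mul, ← integral_const_mul,
      ← integral_add ((i2 _ _).const_mul _) ((i2 _ _).const_mul _),
      ← integral_add (k2 _ _) ((i2 _ _).const_mul _)]
    congr 1 with x; simp; ring
  have e5 : ∫ g, (π * f (g, true) + (1 - π) * f (g, false)) ∂Θ =
      π * ∫ g, f (g, true) ∂Θ + (1 - π) * ∫ g, f (g, false) ∂Θ := by
    rw [integral_add ((i1 _).const_mul _) ((i1 _).const_mul _), integral_const_mul,
      integral_const_mul]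
  rw [e1, e2, e3, e4, e5]
  simp only [smul_eq_mul]
  ring

lemma ae_signLaw_abs_le (h : ℝ) : ∀ᵐ v ∂signLaw h, |v| ≤ |h| := by
  have : MeasurableSet {v : ℝ | |v| ≤ |h|} := measurableSet_le (by fun_prop) (by fun_prop)
  rw [signLaw, ae_add_measure_iff]
  constructor <;> refine Measure.ae_smul_measure ?_ _ <;> simp

lemma integral_signLaw (h : ℝ) : ∫ v, v ∂signLaw h = 0 := by
  have hi : ∀ b : ℝ, Integrable (fun v : ℝ => v) (Measure.dirac b) := fun b =>
    integrable_dirac (by simp)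
  rw [signLaw, integral_add_measure ((hi _).smul_measure (by simp))
    ((hi _).smul_measure (by simp)), integral_smul_measure, integral_smul_measure,
    integral_dirac, integral_dirac]
  simp

lemma ae_perturbationLaw_abs_le (h : ℝ) :
    ∀ᵐ v ∂perturbationLaw J h, ∀ j, |v j| ≤ |h| := by
  rw [perturbationLaw, ae_map_iff (WithLp.measurable_toLp 2 _).aemeasurable]
  · rw [ae_all_iff]
    intro j
    have := (measurePreserving_eval (fun _ : Fin J => signLaw h) j).quasiMeasurePreserving.ae
      (ae_signLaw_abs_le h)
    simpa using this
  · simp only [Set.ofPred_forall]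
    exact .iInter fun j => measurableSet_le (by fun_prop) (by fun_prop)

lemma integral_perturbationLaw_apply (h : ℝ) (j : Fin J) :
    ∫ v, v j ∂perturbationLaw J h = 0 := by
  have hm := measurePreserving_eval (fun _ : Fin J => signLaw h) j
  rw [perturbationLaw, integral_map (WithLp.measurable_toLp 2 _).aemeasurable (by fun_prop)]
  have := integral_map hm.measurable.aemeasurable (f := fun v : ℝ => v)
    (by fun_prop) (μ := Measure.pi fun _ : Fin J => signLaw h)
  rw [hm.map_eq, integral_signLaw] at this
  exact this.symm

lemma integral_perturbationLaw_clm (h : ℝ) (L : Price J →L[ℝ] ℝ) :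
    ∫ v, L v ∂perturbationLaw J h = 0 := by
  rw [integral_congr_ae (ae_of_all _ fun v => clm_apply_eq_sum L v)]
  rw [integral_finsetSum]
  · simp_rw [smul_eq_mul, integral_mul_const, integral_perturbationLaw_apply, zero_mul, Finset.sum_const_zero]
  · intro j _
    refine Integrable.mul_const (.of_bound (by fun_prop) |h| ?_) _
    filter_upwards [ae_perturbationLaw_abs_le h] with v hv using hv j

end Laws

/-! ### Convergence to zero in probability -/

section InMeasure

variable {Ω : Type*} [MeasurableSpace Ω] {μ : Measure Ω} {X Y A D : ℕ → Ω → ℝ}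

lemma tendstoInMeasure_zero_iff :
    TendstoInMeasure μ X atTop 0 ↔
      ∀ ε, 0 < ε → Tendsto (fun n => μ {ω | ε ≤ |X n ω|}) atTop (𝓝 0) := by
  simp [tendstoInMeasure_iff_norm]

lemma TendstoInMeasure.zero_of_measure_le {f : ℕ → ℝ → ℝ≥0∞}
    (hf : ∀ ε, 0 < ε → Tendsto (fun n => f n ε) atTop (𝓝 0))
    (h : ∀ ε, 0 < ε → ∀ n, μ {ω | ε ≤ |X n ω|} ≤ f n ε) : TendstoInMeasure μ X atTop 0 :=
  tendstoInMeasure_zero_iff.2 fun ε hε =>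
    tendsto_of_tendsto_of_tendsto_of_le_of_le tendsto_const_nhds (hf ε hε) (fun _ => zero_le)
      (h ε hε)

lemma TendstoInMeasure.zero_of_abs_le_add (hX : TendstoInMeasure μ X atTop 0)
    (hY : TendstoInMeasure μ Y atTop 0) (h : ∀ n ω, |D n ω| ≤ |X n ω| + |Y n ω|) :
    TendstoInMeasure μ D atTop 0 := by
  rw [tendstoInMeasure_zero_iff] at hX hY
  refine TendstoInMeasure.zero_of_measure_le (f := fun n ε =>
    μ {ω | ε / 2 ≤ |X n ω|} + μ {ω | ε / 2 ≤ |Y n ω|}) (fun ε hε => ?_) fun ε hε n => ?_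
  · simpa using (hX _ (half_pos hε)).add (hY _ (half_pos hε))
  · refine (measure_mono fun ω hω => ?_).trans (measure_union_le _ _)
    by_contra hcon
    simp only [Set.mem_union, Set.mem_ofPred_eq, not_or, not_le] at hcon hω
    linarith [h n ω, hcon.1, hcon.2]

lemma TendstoInMeasure.zero_add (hX : TendstoInMeasure μ X atTop 0)
    (hY : TendstoInMeasure μ Y atTop 0) :
    TendstoInMeasure μ (fun n ω => X n ω + Y n ω) atTop 0 :=
  TendstoInMeasure.zero_of_abs_le_add hX hY fun _ _ => abs_add_le _ _

lemma TendstoInMeasure.zero_sum {ι : Type*} (s : Finset ι) {X : ι → ℕ → Ω → ℝ}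
    (hX : ∀ i ∈ s, TendstoInMeasure μ (X i) atTop 0) :
    TendstoInMeasure μ (fun n ω => ∑ i ∈ s, X i n ω) atTop 0 := by
  classical
  induction s using Finset.induction_on with
  | empty =>
    refine tendstoInMeasure_zero_iff.2 fun ε hε => ?_
    simp [not_le.2 hε]
  | insert i s hi ih =>
    simp_rw [Finset.sum_insert hi]
    exact TendstoInMeasure.zero_add (hX i (Finset.mem_insert_self i s))
      (ih fun j hj => hX j (Finset.mem_insert_of_mem hj))

lemma TendstoInMeasure.zero_abs (hX : TendstoInMeasure μ X atTop 0) :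
    TendstoInMeasure μ (fun n ω => |X n ω|) atTop 0 := by
  rw [tendstoInMeasure_zero_iff] at hX ⊢
  simpa using hX

lemma TendstoInMeasure.zero_const_mul (hX : TendstoInMeasure μ X atTop 0) (K : ℝ) :
    TendstoInMeasure μ (fun n ω => K * X n ω) atTop 0 := by
  rw [tendstoInMeasure_zero_iff] at hX
  have hK : 0 < |K| + 1 := by positivity
  refine TendstoInMeasure.zero_of_measure_le (f := fun n ε => μ {ω | ε / (|K| + 1) ≤ |X n ω|})
    (fun ε hε => hX _ (div_pos hε hK)) fun ε hε n => measure_mono fun ω hω => ?_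
  simp only [Set.mem_ofPred_eq, abs_mul] at hω ⊢
  rw [div_le_iff₀ hK]
  nlinarith [abs_nonneg (X n ω)]

lemma TendstoInMeasure.zero_of_tendsto {d : ℕ → ℝ} (hd : Tendsto d atTop (𝓝 0)) :
    TendstoInMeasure μ (fun n _ => d n) atTop 0 := by
  refine tendstoInMeasure_zero_iff.2 fun ε hε => tendsto_const_nhds.congr' ?_
  filter_upwards [(tendsto_order.1 hd.abs).2 ε (by simpa using hε)] with n hn
  simp [not_le.2 hn]

/-- The excess of `|X|` over `|D|` is almost surely zero from some random index on, hence tends to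
zero in probability. This lets a bound valid only in large samples be used. -/
lemma TendstoInMeasure.zero_of_ae_eventually_le [IsFiniteMeasure μ]
    (hXm : ∀ n, AEMeasurable (X n) μ) (hDm : ∀ n, AEMeasurable (D n) μ)
    (hD : TendstoInMeasure μ D atTop 0) (h : ∀ᵐ ω ∂μ, ∀ᶠ n in atTop, |X n ω| ≤ D n ω) :
    TendstoInMeasure μ X atTop 0 := by
  have hf : TendstoInMeasure μ (fun n ω => max 0 (|X n ω| - |D n ω|)) atTop 0 := by
    refine tendstoInMeasure_of_tendsto_ae (fun n => ?_) ?_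
    · have h1 := hXm n
      have h2 := hDm n
      exact AEMeasurable.aestronglyMeasurable (by fun_prop)
    · filter_upwards [h] with ω hω
      refine tendsto_const_nhds.congr' ?_
      filter_upwards [hω] with n hn
      simp [hn.trans (le_abs_self _)]
  refine TendstoInMeasure.zero_of_abs_le_add hD hf fun n ω => ?_
  rw [abs_of_nonneg (le_max_left 0 (|X n ω| - |D n ω|))]
  linarith [le_max_right 0 (|X n ω| - |D n ω|)]

/-- A sequence bounded in probability times one that tends to zero almost surely. -/
lemma TendstoInMeasure.zero_mul_of_tight [IsFiniteMeasure μ] (hAm : ∀ n, AEMeasurable (A n) μ)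
    (hA : ∀ᵐ ω ∂μ, Tendsto (fun n => A n ω) atTop (𝓝 0)) {b : ℝ}
    (hX : ∀ n c, 0 < c → μ {ω | c ≤ |X n ω|} ≤ ENNReal.ofReal (b ^ 2 / c ^ 2)) :
    TendstoInMeasure μ (fun n ω => A n ω * X n ω) atTop 0 := by
  have hA' : TendstoInMeasure μ A atTop 0 :=
    tendstoInMeasure_of_tendsto_ae (fun n => (hAm n).aestronglyMeasurable) hA
  rw [tendstoInMeasure_zero_iff] at hA' ⊢
  intro ε hε
  rw [ENNReal.tendsto_nhds_zero]
  intro η hη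
  have hlim : Tendsto (fun c : ℝ => ENNReal.ofReal (b ^ 2 / c ^ 2)) atTop (𝓝 0) := by
    have : Tendsto (fun c : ℝ => b ^ 2 / c ^ 2) atTop (𝓝 0) :=
      tendsto_const_nhds.div_atTop (tendsto_pow_atTop (by norm_num))
    simpa using ENNReal.tendsto_ofReal this
  -- The level `c` is fixed first, making the tail of `X` small uniformly in `n`; only then is `n`
  -- taken large, to make `A` small at level `ε / c`.
  obtain ⟨c, hc, hc0⟩ := ((ENNReal.tendsto_nhds_zero.1 hlim (η / 2)
    (ENNReal.half_pos hη.ne')).and (eventually_gt_atTop 0)).exists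
  filter_upwards [ENNReal.tendsto_nhds_zero.1 (hA' (ε / c) (div_pos hε hc0)) (η / 2)
    (ENNReal.half_pos hη.ne')] with n hn
  calc μ {ω | ε ≤ |A n ω * X n ω|}
      ≤ μ ({ω | ε / c ≤ |A n ω|} ∪ {ω | c ≤ |X n ω|}) := measure_mono fun ω hω => by
        by_contra hcon
        simp only [Set.mem_union, Set.mem_ofPred_eq, not_or, not_le] at hcon hω
        rw [abs_mul] at hω
        have h1 : |A n ω| * |X n ω| ≤ |A n ω| * c :=
          mul_le_mul_of_nonneg_left hcon.2.le (abs_nonneg _)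
        have h2 := (lt_div_iff₀ hc0).1 hcon.1
        linarith
    _ ≤ μ {ω | ε / c ≤ |A n ω|} + μ {ω | c ≤ |X n ω|} := measure_union_le _ _
    _ ≤ η / 2 + η / 2 := add_le_add hn ((hX n c hc0).trans hc)
    _ = η := ENNReal.add_halves η

end InMeasure

/-! ### Independence and limit theorems in the experiment -/

namespace Market.IsExperiment

variable {𝒢 : Type*} [MeasurableSpace 𝒢] {J : ℕ} {Θ : Measure 𝒢} [IsProbabilityMeasure Θ] {π : ℝ}
  {Ω : Type*} [MeasurableSpace Ω] {μ : Measure Ω}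
  {h : ℕ → ℝ} {g : ℕ → Ω → 𝒢} {W : ℕ → Ω → Bool} {U : (n : ℕ) → Fin n → Ω → Price J}
  [IsProbabilityMeasure (treatmentLaw π)]

lemma hasLaw_individual (hexp : Market.IsExperiment J μ Θ π h g W U) (n : ℕ) (i : Fin n) :
    HasLaw (fun ω => (g i ω, W i ω, U n i ω))
      (Θ.prod ((treatmentLaw π).prod (perturbationLaw J (h n)))) μ :=
  (measurePreserving_eval (fun _ : Fin n =>
    Θ.prod ((treatmentLaw π).prod (perturbationLaw J (h n)))) i).hasLaw.comp (hexp n)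

/-- Types and treatments do not depend on the sample size, so the law can be read off the sample of
size `i + 1`, where `i` is the last individual. -/
lemma hasLaw_type_treatment (hexp : Market.IsExperiment J μ Θ π h g W U) (i : ℕ) :
    HasLaw (fun ω => (g i ω, W i ω)) (Θ.prod (treatmentLaw π)) μ :=
  (((MeasurePreserving.id Θ).prod measurePreserving_fst).hasLaw).comp
    (hexp.hasLaw_individual (i + 1) (Fin.last i))

lemma hasLaw_perturbation (hexp : Market.IsExperiment J μ Θ π h g W U) (n : ℕ) (i : Fin n) :
    HasLaw (U n i) (perturbationLaw J (h n)) μ :=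
  (measurePreserving_snd.comp measurePreserving_snd).hasLaw.comp (hexp.hasLaw_individual n i)

lemma ae_abs_perturbation_le (hexp : Market.IsExperiment J μ Θ π h g W U) :
    ∀ᵐ ω ∂μ, ∀ n i j, |U n i ω j| ≤ |h n| := by
  rw [ae_all_iff]; intro n
  rw [ae_all_iff]; intro i
  have hlaw := hexp.hasLaw_perturbation n i
  have := ae_perturbationLaw_abs_le (J := J) (h n)
  rw [← hlaw.map_eq] at this
  exact ae_of_ae_map hlaw.aemeasurable this

lemma identDistrib_comp {F : Type*} [MeasurableSpace F]
    (hexp : Market.IsExperiment J μ Θ π h g W U) {φ : 𝒢 × Bool → F} (hφ : Measurable φ) (i : ℕ) :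
    IdentDistrib (fun ω => φ (g i ω, W i ω)) (fun ω => φ (g 0 ω, W 0 ω)) μ μ :=
  (IdentDistrib.mk (hexp.hasLaw_type_treatment i).aemeasurable
    (hexp.hasLaw_type_treatment 0).aemeasurable
    ((hexp.hasLaw_type_treatment i).map_eq.trans (hexp.hasLaw_type_treatment 0).map_eq.symm)).comp
    hφ

variable [IsProbabilityMeasure μ]

lemma iIndepFun_individual (hexp : Market.IsExperiment J μ Θ π h g W U) (n : ℕ) :
    iIndepFun (fun (i : Fin n) ω => (g i ω, W i ω, U n i ω)) μ :=
  (iIndepFun_iff_hasLaw_pi_pi fun i => hexp.hasLaw_individual n i).2 (hexp n)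

/-- Independence of a sequence is a statement about finite index sets, and every finite set of
individuals lies in one sufficiently large sample. -/
lemma iIndepFun_type_treatment (hexp : Market.IsExperiment J μ Θ π h g W U) :
    iIndepFun (fun i ω => (g i ω, W i ω)) μ := by
  rw [iIndepFun_iff_finset]
  intro s
  have hs : ∀ i ∈ s, i < s.sup id + 1 := fun i hi => Nat.lt_succ_of_le (Finset.le_sup (f := id) hi)
  have h1 := (hexp.iIndepFun_individual (s.sup id + 1)).comp
    (fun _ t => (t.1, t.2.1)) (fun _ => by fun_prop)
  exact h1.precomp (g := fun i : s => (⟨i, hs i i.2⟩ : Fin (s.sup id + 1)))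
    fun i j hij => Subtype.ext (by simpa using hij)

variable {E : Type*} [NormedAddCommGroup E] [NormedSpace ℝ E] [CompleteSpace E]
  [MeasurableSpace E] [BorelSpace E] [SecondCountableTopology E]

/-- Law of large numbers for a bounded function of type and treatment. -/
lemma ae_tendsto_average (hexp : Market.IsExperiment J μ Θ π h g W U) {φ : 𝒢 × Bool → E}
    (hφ : Measurable φ) {C : ℝ} (hC : ∀ x, ‖φ x‖ ≤ C) :
    ∀ᵐ ω ∂μ, Tendsto (fun n : ℕ => (n : ℝ)⁻¹ • ∑ i : Fin n, φ (g i ω, W i ω)) atTop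
      (𝓝 (∫ x, φ x ∂Θ.prod (treatmentLaw π))) := by
  have hm : ∀ i, AEMeasurable (fun ω => φ (g i ω, W i ω)) μ := fun i =>
    hφ.comp_aemeasurable (hexp.hasLaw_type_treatment i).aemeasurable
  have := strong_law_ae (μ := μ) (fun i ω => φ (g i ω, W i ω))
    (.of_bound (hm 0).aestronglyMeasurable C (ae_of_all _ fun ω => hC _))
    (fun i j hij => (hexp.iIndepFun_type_treatment.indepFun hij).comp hφ hφ)
    (hexp.identDistrib_comp hφ)
  have hlim : ∫ ω, φ (g 0 ω, W 0 ω) ∂μ = ∫ x, φ x ∂Θ.prod (treatmentLaw π) :=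
    (hexp.hasLaw_type_treatment 0).integral_comp hφ.aestronglyMeasurable
  rw [hlim] at this
  simpa only [Finset.sum_range] using this

/-- Central limit theorem for a bounded function of type and treatment. -/
lemma tendstoInDistribution_average (hexp : Market.IsExperiment J μ Θ π h g W U)
    {φ : 𝒢 × Bool → ℝ} (hφ : Measurable φ) {C : ℝ} (hC : ∀ x, |φ x| ≤ C) :
    TendstoInDistribution
      (fun (n : ℕ) ω => √(n : ℝ) * ((n : ℝ)⁻¹ * ∑ i : Fin n, φ (g i ω, W i ω)
        - ∫ x, φ x ∂Θ.prod (treatmentLaw π)))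
      atTop id (fun _ => μ)
      (gaussianReal 0 (variance φ (Θ.prod (treatmentLaw π))).toNNReal) := by
  have hlaw := hexp.hasLaw_type_treatment 0
  have hm : AEMeasurable (fun ω => φ (g 0 ω, W 0 ω)) μ := hφ.comp_aemeasurable hlaw.aemeasurable
  have hlim : ∫ ω, φ (g 0 ω, W 0 ω) ∂μ = ∫ x, φ x ∂Θ.prod (treatmentLaw π) :=
    hlaw.integral_comp hφ.aestronglyMeasurable
  have hvar : variance (fun ω => φ (g 0 ω, W 0 ω)) μ = variance φ (Θ.prod (treatmentLaw π)) := by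
    rw [← hlaw.map_eq, variance_map (by rw [hlaw.map_eq]; exact hφ.aemeasurable) hlaw.aemeasurable]
    rfl
  have := tendstoInDistribution_inv_sqrt_mul_sum_sub (P := μ)
    (X := fun i ω => φ (g i ω, W i ω)) (Y := id)
    (P' := gaussianReal 0 (variance φ (Θ.prod (treatmentLaw π))).toNNReal)
    (by simp only [hvar]; exact HasLaw.id)
    (.of_bound hm.aestronglyMeasurable C (ae_of_all _ fun ω => hC _))
    (hexp.iIndepFun_type_treatment.comp (fun _ => φ) fun _ => hφ)
    (hexp.identDistrib_comp hφ)
  simp only [hlim, Finset.sum_range] at this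
  convert this using 3 with n ω
  rcases Nat.eq_zero_or_pos n with rfl | hn
  · simp
  · have hn' : (0 : ℝ) < n := by exact_mod_cast hn
    have hs : √(n : ℝ) ≠ 0 := (Real.sqrt_pos.2 hn').ne'
    have hs2 : (n : ℝ) = √n * √n := (Real.mul_self_sqrt hn'.le).symm
    field_simp
    rw [Real.sq_sqrt hn'.le]

/-- Chebyshev's inequality for the normalized average of a centred bounded function of type,
treatment and perturbation. -/
lemma measure_abs_sqrt_mul_average_ge_le (hexp : Market.IsExperiment J μ Θ π h g W U) (n : ℕ)
    {ψ : 𝒢 × Bool × Price J → ℝ} (hψ : Measurable ψ) {b : ℝ}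
    (hb : ∀ᵐ t ∂Θ.prod ((treatmentLaw π).prod (perturbationLaw J (h n))), |ψ t| ≤ b)
    (h0 : ∫ t, ψ t ∂Θ.prod ((treatmentLaw π).prod (perturbationLaw J (h n))) = 0)
    {c : ℝ} (hc : 0 < c) :
    μ {ω | c ≤ |√(n : ℝ) * ((n : ℝ)⁻¹ * ∑ i : Fin n, ψ (g i ω, W i ω, U n i ω))|}
      ≤ ENNReal.ofReal (b ^ 2 / c ^ 2) := by
  set X : Fin n → Ω → ℝ := fun i ω => ψ (g i ω, W i ω, U n i ω) with hX
  have hm : ∀ i, AEMeasurable (X i) μ := fun i =>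
    hψ.comp_aemeasurable (hexp.hasLaw_individual n i).aemeasurable
  have hXb : ∀ i, ∀ᵐ ω ∂μ, |X i ω| ≤ b := fun i => by
    have hlaw := hexp.hasLaw_individual n i
    rw [← hlaw.map_eq] at hb
    exact ae_of_ae_map hlaw.aemeasurable hb
  have hX0 : ∀ i, ∫ ω, X i ω ∂μ = 0 := fun i =>
    ((hexp.hasLaw_individual n i).integral_comp hψ.aestronglyMeasurable).trans h0
  have hL2 : ∀ i, MemLp (X i) 2 μ := fun i => .of_bound (hm i).aestronglyMeasurable b (hXb i)
  have hsum : MemLp (∑ i, X i) 2 μ := memLp_finsetSum' _ fun i _ => hL2 i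
  have hS : MemLp (fun ω => √(n : ℝ) * ((n : ℝ)⁻¹ * (∑ i, X i) ω)) 2 μ :=
    (hsum.const_mul _).const_mul _
  have hmean : ∫ ω, √(n : ℝ) * ((n : ℝ)⁻¹ * (∑ i, X i) ω) ∂μ = 0 := by
    rw [integral_const_mul, integral_const_mul]
    simp only [Finset.sum_apply]
    rw [integral_finsetSum _ fun i _ => (hL2 i).integrable (by norm_num)]
    simp [hX0]
  have hvar : variance (fun ω => √(n : ℝ) * ((n : ℝ)⁻¹ * (∑ i, X i) ω)) μ ≤ b ^ 2 := by
    rw [variance_const_mul, variance_const_mul, IndepFun.variance_sum (fun i _ => hL2 i)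
      (fun i _ j _ hij => ((hexp.iIndepFun_individual n).indepFun hij).comp hψ hψ)]
    have h1 : ∀ i, variance (X i) μ ≤ b ^ 2 := fun i => by
      -- Popoviciu's inequality: the squared half-length of `[-b, b]` is `b ^ 2`.
      refine (variance_le_sq_of_bounded (a := -b) (b := b) ?_ (hm i)).trans_eq (by ring)
      filter_upwards [hXb i] with ω hω using abs_le.1 hω
    rcases Nat.eq_zero_or_pos n with rfl | hn
    · simpa using sq_nonneg b
    · have hn' : (0 : ℝ) < n := by exact_mod_cast hn
      calc √(n : ℝ) ^ 2 * ((n : ℝ)⁻¹ ^ 2 * ∑ i, variance (X i) μ)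
          ≤ √(n : ℝ) ^ 2 * ((n : ℝ)⁻¹ ^ 2 * ∑ _i : Fin n, b ^ 2) := by
            gcongr with i; exact h1 i
        _ = b ^ 2 := by
            rw [Real.sq_sqrt hn'.le]; simp; field_simp
  have := meas_ge_le_variance_div_sq hS hc
  rw [hmean] at this
  simp only [sub_zero, Finset.sum_apply] at this
  refine this.trans (ENNReal.ofReal_le_ofReal ?_)
  simp only [← Finset.sum_apply]
  gcongr

/-- The sample frequency of treated individuals with type in `A` converges to `π Θ(A) ≠ 0`, so it is
eventually nonzero. -/
lemma ae_eventually_exists_mem (hexp : Market.IsExperiment J μ Θ π h g W U) (h₀ : 0 < π)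
    {A : Set 𝒢} (hA : MeasurableSet A) (hpos : 0 < Θ A) :
    ∀ᵐ ω ∂μ, ∀ᶠ n : ℕ in atTop, ∃ i : Fin n, g i ω ∈ A ∧ W i ω = true := by
  have hB : MeasurableSet (A ×ˢ ({true} : Set Bool)) := hA.prod (measurableSet_singleton _)
  have hlaw := hexp.ae_tendsto_average (φ := (A ×ˢ ({true} : Set Bool)).indicator fun _ => (1 : ℝ))
    (measurable_const.indicator hB) (C := 1) (fun x => by
      classical rw [Set.indicator_apply]; split_ifs <;> simp)
  have hne : ∫ x, (A ×ˢ ({true} : Set Bool)).indicator (fun _ => (1 : ℝ)) x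
      ∂Θ.prod (treatmentLaw π) ≠ 0 := by
    rw [integral_indicator_const _ hB, smul_eq_mul, mul_one, Measure.real, Measure.prod_prod,
      ENNReal.toReal_ne_zero]
    refine ⟨mul_ne_zero hpos.ne' ?_, ENNReal.mul_ne_top (measure_ne_top _ _) (measure_ne_top _ _)⟩
    simp [treatmentLaw, h₀]
  filter_upwards [hlaw] with ω hω
  filter_upwards [hω.eventually_ne hne] with n hn
  by_contra hcon
  push Not at hcon
  refine hn ?_
  rw [Finset.sum_eq_zero, smul_zero]
  intro i _
  refine Set.indicator_of_notMem (fun hi => ?_) _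
  exact hcon i hi.1 hi.2

end Market.IsExperiment

/-! ### Deterministic expansions of perturbed averages -/

section Average

variable {E F : Type*} [NormedAddCommGroup E] [NormedSpace ℝ E] [NormedAddCommGroup F]
  [NormedSpace ℝ F] {n : ℕ}

/-- The assumption `0 ≤ b` covers `n = 0`, where the average is `0`. -/
lemma norm_average_le {v : Fin n → E} {b : ℝ} (hb : 0 ≤ b) (hv : ∀ i, ‖v i‖ ≤ b) :
    ‖(n : ℝ)⁻¹ • ∑ i, v i‖ ≤ b := by
  rcases Nat.eq_zero_or_pos n with rfl | hn
  · simpa using hb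
  · have hn' : (0 : ℝ) < n := by exact_mod_cast hn
    rw [norm_smul, norm_inv, Real.norm_natCast, inv_mul_le_iff₀ hn']
    simpa using norm_sum_le_of_le Finset.univ fun i _ => hv i

lemma average_clm_apply (L : Fin n → E →L[ℝ] F) (v : E) :
    ((n : ℝ)⁻¹ • ∑ i, L i) v = (n : ℝ)⁻¹ • ∑ i, L i v := by
  simp [sum_apply]

end Average

namespace SmoothFamily

variable {X E : Type*} [MeasurableSpace X] {J : ℕ} [NormedAddCommGroup E]
    [NormedSpace ℝ E] [MeasurableSpace E]
    {G : X → Price J → E} {l u : Price J} {δ η C : ℝ} {n : ℕ} {x : Fin n → X}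
    {U : Fin n → Price J}

/-- First-order expansion of a perturbed average. -/
lemma norm_average_expansion_le (hG : SmoothFamily G (priceBox l u δ) C) (hC : 0 ≤ C)
    (hη : 0 ≤ η) (hηδ : 2 * η ≤ δ) (hU : ∀ i j, |U i j| ≤ η) {p q : Price J}
    (hp : p ∈ priceBox l u 0) (hq : q ∈ priceBox l u η) :
    ‖(n : ℝ)⁻¹ • ∑ i, G (x i) (q + U i) - (n : ℝ)⁻¹ • ∑ i, G (x i) p
        - ((n : ℝ)⁻¹ • ∑ i, fderiv ℝ (G (x i)) p) (q - p)
        - (n : ℝ)⁻¹ • ∑ i, fderiv ℝ (G (x i)) p (U i)‖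
      ≤ 2 * C * (‖q - p‖ ^ 2 + J * η ^ 2) := by
  have hp' : p ∈ priceBox l u δ := priceBox_mono (by linarith) hp
  rw [average_clm_apply, ← smul_sub, ← smul_sub, ← smul_sub, ← Finset.sum_sub_distrib,
    ← Finset.sum_sub_distrib, ← Finset.sum_sub_distrib]
  refine norm_average_le (by positivity) fun i => ?_
  have hqU : q + U i ∈ priceBox l u δ := priceBox_mono (by linarith) (add_mem_priceBox hq (hU i))
  have h1 := hG.norm_taylor_le convex_priceBox hC (x i) hp' hqU
  have h2 : q + U i - p = (q - p) + U i := by abel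
  rw [h2, map_add, ← sub_sub] at h1
  refine h1.trans ?_
  have h3 : ‖U i‖ ≤ √J * η := norm_le_sqrt_mul_of_abs_le hη (hU i)
  have h4 : ‖q - p + U i‖ ≤ ‖q - p‖ + √J * η := (norm_add_le _ _).trans (by gcongr)
  have h5 : (√J * η) ^ 2 = J * η ^ 2 := by rw [mul_pow, Real.sq_sqrt (Nat.cast_nonneg J)]
  calc C * ‖q - p + U i‖ ^ 2 ≤ C * (‖q - p‖ + √J * η) ^ 2 := by gcongr
    _ ≤ C * (2 * (‖q - p‖ ^ 2 + (√J * η) ^ 2)) := by gcongr; exact add_sq_le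
    _ = _ := by rw [h5]; ring

lemma norm_average_fderiv_apply_perturbation_le (hG : SmoothFamily G (priceBox l u δ) C)
    (hC : 0 ≤ C) (hη : 0 ≤ η) (hδ : 0 ≤ δ) (hU : ∀ i j, |U i j| ≤ η) {p : Price J}
    (hp : p ∈ priceBox l u 0) :
    ‖(n : ℝ)⁻¹ • ∑ i, fderiv ℝ (G (x i)) p (U i)‖ ≤ C * (√J * η) := by
  refine norm_average_le (by positivity) fun i => ?_
  exact (ContinuousLinearMap.le_opNorm _ _).trans (mul_le_mul
    (hG.norm_fderiv_le _ _ (priceBox_mono hδ hp)) (norm_le_sqrt_mul_of_abs_le hη (hU i))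
    (norm_nonneg _) hC)

/-- If the average Jacobian of `p ↦ G p + p` is less than `1` on a net of the box, then the
perturbed average is a contraction on a slightly larger box. -/
lemma norm_average_add_sub_le {G : X → Price J → Price J}
    (hG : SmoothFamily G (priceBox l u δ) C) (hC : 0 ≤ C)
    (hlu : ∀ j, l j ≤ u j) (hη : 0 ≤ η) (hηδ : 2 * η ≤ δ) (hU : ∀ i j, |U i j| ≤ η)
    {t : Set (Price J)} {r K : ℝ} (ht : t ⊆ priceBox l u 0)
    (hcov : ∀ p ∈ priceBox l u 0, ∃ q ∈ t, ‖p - q‖ ≤ r)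
    (hK : ∀ q ∈ t, ‖(n : ℝ)⁻¹ • ∑ i, fderiv ℝ (G (x i)) q + .id ℝ (Price J)‖ ≤ K)
    {p q : Price J} (hp : p ∈ priceBox l u η) (hq : q ∈ priceBox l u η) :
    ‖((n : ℝ)⁻¹ • ∑ i, G (x i) (p + U i) + p) - ((n : ℝ)⁻¹ • ∑ i, G (x i) (q + U i) + q)‖
      ≤ (K + C * (r + 2 * (√J * η))) * ‖p - q‖ := by
  have hmem : ∀ p ∈ priceBox l u η, ∀ i, p + U i ∈ priceBox l u δ := fun p hp i =>
    priceBox_mono (by linarith) (add_mem_priceBox hp (hU i))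
  refine (convex_priceBox (l := l) (u := u) (δ := η)).norm_image_sub_le_of_norm_hasFDerivWithin_le
    (𝕜 := ℝ) (f := fun p => (n : ℝ)⁻¹ • ∑ i, G (x i) (p + U i) + p)
    (f' := fun p => (n : ℝ)⁻¹ • ∑ i, fderiv ℝ (G (x i)) (p + U i) + .id ℝ (Price J))
    (fun p hp => HasFDerivAt.hasFDerivWithinAt ?_) (fun p hp => ?_) hq hp
  · refine HasFDerivAt.fun_add (HasFDerivAt.fun_const_smul (HasFDerivAt.fun_sum fun i _ => ?_) _)
      (hasFDerivAt_id p)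
    exact (hasFDerivAt_comp_add_right (U i)).2
      (hG.differentiableAt (x i) _ (hmem p hp i)).hasFDerivAt
  -- The perturbed point is compared with a net point: clamping `p` back to the original box costs
  -- `√J * η`, the perturbation costs the same again, and the net costs `r`.
  · have hc : boxClamp l u 0 p ∈ priceBox l u 0 :=
      boxClamp_mem (fun j => by linarith [hlu j]) p
    obtain ⟨q, hqt, hq⟩ := hcov _ hc
    have hqδ : q ∈ priceBox l u δ := priceBox_mono (by linarith) (ht hqt)
    have h1 : ‖p - boxClamp l u 0 p‖ ≤ √J * η := norm_le_sqrt_mul_of_abs_le hη fun j => by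
      obtain ⟨h2, h3⟩ := hp j
      simp only [PiLp.sub_apply, boxClamp_apply, sub_zero, add_zero]
      rw [abs_le]
      constructor
      · have : max (l j) (min (p j) (u j)) ≤ p j + η :=
          max_le (by linarith) ((min_le_left _ _).trans (by linarith))
        linarith
      · have : p j - η ≤ max (l j) (min (p j) (u j)) :=
          le_max_of_le_right (le_min (by linarith) (by linarith))
        linarith
    have h2 : ∀ i, ‖p + U i - q‖ ≤ r + 2 * (√J * η) := fun i => by
      have e : p + U i - q = (p - boxClamp l u 0 p) + U i + (boxClamp l u 0 p - q) := by abel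
      have h3 : ‖U i‖ ≤ √J * η := norm_le_sqrt_mul_of_abs_le hη (hU i)
      rw [e]
      refine (norm_add₃_le).trans ?_
      linarith
    have hr : 0 ≤ r + 2 * (√J * η) := by
      have := norm_nonneg (boxClamp l u 0 p - q)
      have : 0 ≤ √J * η := by positivity
      linarith
    have e : (n : ℝ)⁻¹ • ∑ i, fderiv ℝ (G (x i)) (p + U i) + .id ℝ (Price J) =
        ((n : ℝ)⁻¹ • ∑ i, fderiv ℝ (G (x i)) q + .id ℝ (Price J)) +
        (n : ℝ)⁻¹ • ∑ i, (fderiv ℝ (G (x i)) (p + U i) - fderiv ℝ (G (x i)) q) := by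
      rw [Finset.sum_sub_distrib, smul_sub]; abel
    rw [e]
    refine (norm_add_le _ _).trans (add_le_add (hK q hqt) (norm_average_le (by positivity) ?_))
    intro i
    exact (hG.norm_fderiv_sub_le (x i) _ (hmem p hp i) q hqδ).trans (by gcongr; exact h2 i)

end SmoothFamily

/-- Eliminating the price deviation `Δ` from the linearized clearing condition. -/
lemma abs_linearized_remainder_le {V : Type*} [NormedAddCommGroup V] [NormedSpace ℝ V]
    {A H Hi : V →L[ℝ] V} {A' a : V →L[ℝ] ℝ} {S Q ρ Δ : V} {Q' ρ' κ : ℝ}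
    (hHi : ∀ v, Hi (H v) = v) (h0 : S + A Δ + Q + ρ = 0) (hκ : ‖a.comp Hi‖ ≤ κ) :
    |A' Δ + Q' + ρ' + a.comp Hi S| ≤
      (‖A' - a‖ + κ * ‖A - H‖) * ‖Δ‖ + |Q'| + κ * ‖Q‖ + |ρ'| + κ * ‖ρ‖ := by
  -- The clearing identity is solved for `H Δ` by writing `A = H + (A - H)`, and `a.comp Hi` is then
  -- applied. Only a left inverse of `H` is needed.
  have h1 : a Δ = -(a.comp Hi S) - a.comp Hi (Q + ρ + (A - H) Δ) := by
    have : H Δ = -S - (Q + ρ + (A - H) Δ) := by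
      have e : H Δ - (-S - (Q + ρ + (A - H) Δ)) = S + A Δ + Q + ρ := by
        rw [sub_apply]; abel
      rwa [h0, sub_eq_zero] at e
    have h2 : a.comp Hi (H Δ) = a Δ := by rw [ContinuousLinearMap.comp_apply, hHi]
    rw [← h2, this, map_sub, map_neg]
  have h2 : A' Δ + Q' + ρ' + a.comp Hi S =
      (A' - a) Δ + Q' + ρ' - a.comp Hi (Q + ρ + (A - H) Δ) := by
    rw [sub_apply, h1]; ring
  have h3 : |(A' - a) Δ| ≤ ‖A' - a‖ * ‖Δ‖ := (A' - a).le_opNorm Δ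
  have hκ0 : 0 ≤ κ := (norm_nonneg _).trans hκ
  have h4 : |a.comp Hi (Q + ρ + (A - H) Δ)| ≤ κ * (‖Q‖ + ‖ρ‖ + ‖A - H‖ * ‖Δ‖) := by
    refine ((a.comp Hi).le_opNorm _).trans (mul_le_mul hκ ?_ (norm_nonneg _) hκ0)
    refine (norm_add₃_le).trans ?_
    gcongr
    exact (A - H).le_opNorm Δ
  rw [h2]
  refine (abs_sub _ _).trans ?_
  have h5 := abs_add_three ((A' - a) Δ) Q' ρ'
  linarith

lemma SmoothFamily.mono {X E : Type*} [MeasurableSpace X] {J : ℕ} [NormedAddCommGroup E]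
    [NormedSpace ℝ E] [MeasurableSpace E] {G : X → Price J → E} {s : Set (Price J)} {C C' : ℝ}
    (h : SmoothFamily G s C) (hC : C ≤ C') : SmoothFamily G s C' where
  measurable := h.measurable
  differentiableAt := h.differentiableAt
  norm_le x p hp := (h.norm_le x p hp).trans hC
  norm_fderiv_le x p hp := (h.norm_fderiv_le x p hp).trans hC
  norm_fderiv_sub_le x p hp q hq := (h.norm_fderiv_sub_le x p hp q hq).trans (by gcongr)

lemma average_apply {J n : ℕ} (v : Fin n → Price J) (j : Fin J) :
    ((n : ℝ)⁻¹ • ∑ i, v i) j = (n : ℝ)⁻¹ * ∑ i, v i j := by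
  simp

/-! ### The mean-field market, exact clearing and the influence function -/

namespace Market

variable {𝒢 : Type*} [MeasurableSpace 𝒢] {J : ℕ} {M : Market 𝒢 J} {Θ : Measure 𝒢}
  {π : ℝ} {l u : Price J} {δ C : ℝ}

/-- The inverse-probability weighted outcome. -/
noncomputable def weightedOutcome (M : Market 𝒢 J) (π : ℝ) (x : 𝒢 × Bool) (p : Price J) : ℝ :=
  (if x.2 then π⁻¹ else -(1 - π)⁻¹) • M.outcome x.1 x.2 p

/-- Individual excess demand as a function of type and treatment jointly. -/
def excessOf (M : Market 𝒢 J) (x : 𝒢 × Bool) (p : Price J) : Price J := M.excess x.1 x.2 p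

lemma measurable_treatment_weight (π : ℝ) :
    Measurable fun x : 𝒢 × Bool => if x.2 then π⁻¹ else -(1 - π)⁻¹ :=
  (measurable_of_finite fun w : Bool => if w then π⁻¹ else -(1 - π)⁻¹).comp measurable_snd

lemma measurable_uncurry_of_forall {E : Type*} [MeasurableSpace E]
    {f : 𝒢 → Bool → Price J → E} (hf : ∀ w, Measurable fun q : 𝒢 × Price J => f q.1 w q.2) :
    Measurable fun q : (𝒢 × Bool) × Price J => f q.1.1 q.1.2 q.2 := by
  have h : Measurable fun q : (𝒢 × Price J) × Bool => f q.1.1 q.2 q.1.2 :=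
    measurable_from_prod_countable_left hf
  exact h.comp (f := fun q : (𝒢 × Bool) × Price J => ((q.1.1, q.2), q.1.2)) (by fun_prop)

lemma measurable_uncurry_weightedOutcome (M : Market 𝒢 J) (π : ℝ) :
    Measurable fun q : (𝒢 × Bool) × Price J => M.weightedOutcome π q.1 q.2 :=
  ((measurable_treatment_weight π).comp measurable_fst).smul
    (measurable_uncurry_of_forall M.measurable_outcome)

lemma smoothFamily_of_forall {E : Type*} [NormedAddCommGroup E] [NormedSpace ℝ E]
    [MeasurableSpace E] {f : 𝒢 → Bool → Price J → E}
    (hf : ∀ w, Measurable fun q : 𝒢 × Price J => f q.1 w q.2)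
    (h : ∀ g w, SmoothBoundedOn (f g w) (priceBox l u δ) C) :
    SmoothFamily (fun x : 𝒢 × Bool => f x.1 x.2) (priceBox l u δ) C :=
  .of_smoothBoundedOn (fun p => (measurable_uncurry_of_forall hf).comp
    (g := fun q : (𝒢 × Bool) × Price J => f q.1.1 q.1.2 q.2) (f := fun x => (x, p)) (by fun_prop))
    convex_priceBox fun x => h x.1 x.2

lemma Smooth.exists_smoothFamily (h : M.Smooth l u) (hπ₀ : 0 < π) (hπ₁ : π < 1) :
    ∃ δ > 0, ∃ C ≥ 0, SmoothFamily M.excessOf (priceBox l u δ) C ∧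
      SmoothFamily (M.weightedOutcome π) (priceBox l u δ) C ∧
      (∀ w, SmoothFamily (fun g => M.outcome g w) (priceBox l u δ) C) ∧
      (∀ w, SmoothFamily (fun g => M.demand g w) (priceBox l u δ) C) ∧
      ∀ w, SmoothFamily (fun g => M.supply g w) (priceBox l u δ) C := by
  obtain ⟨δ, hδ, C₀, h⟩ := h
  set b := π⁻¹ + (1 - π)⁻¹
  have hπ₂ : 0 < 1 - π := sub_pos.2 hπ₁
  have hb : 0 < b := by positivity
  set C := |C₀|
  have hC : C₀ ≤ C := le_abs_self _
  have hC0 : 0 ≤ C := abs_nonneg _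
  -- One constant serves all families: excess demand is a difference of two terms, and the treatment
  -- weights are bounded by `b`.
  have e1 : 2 * C ≤ (2 + b) * C := by gcongr; linarith
  have e2 : b * C ≤ (2 + b) * C := by gcongr; linarith
  have e3 : C₀ ≤ (2 + b) * C := hC.trans (by nlinarith)
  have hout := smoothFamily_of_forall M.measurable_outcome fun g w => (h g w).1
  have hdem := smoothFamily_of_forall M.measurable_demand fun g w => (h g w).2.1
  have hsup := smoothFamily_of_forall M.measurable_supply fun g w => (h g w).2.2
  have key : ∀ {E : Type} [NormedAddCommGroup E] [NormedSpace ℝ E] [MeasurableSpace E]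
      {f : 𝒢 → Bool → Price J → E}, (∀ w, Measurable fun q : 𝒢 × Price J => f q.1 w q.2) →
      (∀ g w, SmoothBoundedOn (f g w) (priceBox l u δ) C₀) → ∀ w,
      SmoothFamily (fun g => f g w) (priceBox l u δ) ((2 + b) * C) := fun hf hg w =>
    (SmoothFamily.of_smoothBoundedOn (fun p => (hf w).comp measurable_prodMk_right)
      convex_priceBox fun g => hg g w).mono e3
  refine ⟨δ, hδ, (2 + b) * C, by positivity, ?_, ?_, key M.measurable_outcome fun g w => (h g w).1,
    key M.measurable_demand fun g w => (h g w).2.1, key M.measurable_supply fun g w => (h g w).2.2⟩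
  · exact ((hdem.mono hC).sub (hsup.mono hC)).mono (by linarith)
  · refine ((hout.mono hC).smul (measurable_treatment_weight π) (b := b) fun x => ?_).mono e2
    split_ifs
    · rw [abs_of_pos (inv_pos.2 hπ₀)]
      exact le_add_of_nonneg_right (inv_pos.2 hπ₂).le
    · rw [abs_neg, abs_of_pos (inv_pos.2 hπ₂)]
      exact le_add_of_nonneg_left (inv_pos.2 hπ₀).le

section Mean

variable [IsProbabilityMeasure Θ]

lemma meanExcess_eq_integral (hπ₀ : 0 ≤ π) (hπ₁ : π ≤ 1)
    (hZ : SmoothFamily M.excessOf (priceBox l u δ) C)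
    (hD : ∀ w, SmoothFamily (fun g => M.demand g w) (priceBox l u δ) C)
    (hS : ∀ w, SmoothFamily (fun g => M.supply g w) (priceBox l u δ) C) {p : Price J}
    (hp : p ∈ priceBox l u δ) :
    M.meanExcess Θ π p = ∫ x, M.excessOf x p ∂Θ.prod (treatmentLaw π) := by
  have := isProbabilityMeasure_treatmentLaw hπ₀ hπ₁
  have hi : ∀ w, Integrable (fun g => M.excess g w p) Θ := fun w =>
    ((hD w).integrable hp).sub ((hS w).integrable hp)
  rw [integral_prod_treatmentLaw hπ₀ hπ₁ (hZ.integrable hp) (hi true) (hi false)]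
  simp only [excessOf, excess, meanExcess, meanDemand, meanSupply]
  rw [integral_sub ((hD true).integrable hp) ((hS true).integrable hp),
    integral_sub ((hD false).integrable hp) ((hS false).integrable hp)]

/-- The inverse-probability weights cancel the treatment probabilities. -/
lemma adeLimit_eq_integral (hπ₀ : 0 < π) (hπ₁ : π < 1)
    (hF : SmoothFamily (M.weightedOutcome π) (priceBox l u δ) C)
    (hY : ∀ w, SmoothFamily (fun g => M.outcome g w) (priceBox l u δ) C) {p : Price J}
    (hp : p ∈ priceBox l u δ) :
    M.adeLimit Θ p = ∫ x, M.weightedOutcome π x p ∂Θ.prod (treatmentLaw π) := by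
  have := isProbabilityMeasure_treatmentLaw hπ₀.le hπ₁.le
  have hπ₂ : 1 - π ≠ 0 := (sub_pos.2 hπ₁).ne'
  have hπ₃ : π ≠ 0 := hπ₀.ne'
  have hi : ∀ w, Integrable (fun g => M.weightedOutcome π (g, w) p) Θ := fun w =>
    ((hY w).integrable hp).smul (if w then π⁻¹ else -(1 - π)⁻¹)
  rw [integral_prod_treatmentLaw hπ₀.le hπ₁.le (hF.integrable hp) (hi true) (hi false)]
  simp only [weightedOutcome, if_true, Bool.false_eq_true, if_false]
  rw [integral_smul, integral_smul]
  simp only [adeLimit, meanOutcome, smul_eq_mul]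
  field_simp
  ring

/-- The margin `δ > 0` makes the integral formula hold on a full neighbourhood of `p`, also at the
boundary of the price box, so the derivatives agree. -/
lemma hasFDerivAt_meanExcess (hπ₀ : 0 ≤ π) (hπ₁ : π ≤ 1)
    (hZ : SmoothFamily M.excessOf (priceBox l u δ) C)
    (hD : ∀ w, SmoothFamily (fun g => M.demand g w) (priceBox l u δ) C)
    (hS : ∀ w, SmoothFamily (fun g => M.supply g w) (priceBox l u δ) C) (hδ : 0 < δ)
    {p : Price J} (hp : p ∈ priceBox l u 0) :
    HasFDerivAt (M.meanExcess Θ π)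
      (∫ x, fderiv ℝ (M.excessOf x) p ∂Θ.prod (treatmentLaw π)) p := by
  have := isProbabilityMeasure_treatmentLaw hπ₀ hπ₁
  have hn := priceBox_mem_nhds hp hδ
  refine (hZ.hasFDerivAt_integral hn).congr_of_eventuallyEq ?_
  filter_upwards [hn] with q hq using meanExcess_eq_integral hπ₀ hπ₁ hZ hD hS hq

lemma hasFDerivAt_adeLimit (hπ₀ : 0 < π) (hπ₁ : π < 1)
    (hF : SmoothFamily (M.weightedOutcome π) (priceBox l u δ) C)
    (hY : ∀ w, SmoothFamily (fun g => M.outcome g w) (priceBox l u δ) C) (hδ : 0 < δ)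
    {p : Price J} (hp : p ∈ priceBox l u 0) :
    HasFDerivAt (M.adeLimit Θ)
      (∫ x, fderiv ℝ (M.weightedOutcome π x) p ∂Θ.prod (treatmentLaw π)) p := by
  have := isProbabilityMeasure_treatmentLaw hπ₀.le hπ₁.le
  have hn := priceBox_mem_nhds hp hδ
  refine (hF.hasFDerivAt_integral hn).congr_of_eventuallyEq ?_
  filter_upwards [hn] with q hq using adeLimit_eq_integral hπ₀ hπ₁ hF hY hq

end Mean

/-- If `u j ≤ l j`, then at the price `u` a type with strict upper choke price would have excess
demand both negative and nonnegative. -/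
lemma PricesBounded.lower_lt_upper (h : M.PricesBounded Θ l u) (j : Fin J) : l j < u j := by
  by_contra! hcon
  obtain ⟨A, -, hA, hlt⟩ := h.upper_strict true j
  obtain ⟨g, hg⟩ := nonempty_of_measure_ne_zero hA.ne'
  exact absurd (h.lower g true j u hcon) (not_le.2 (hlt g hg u le_rfl))

/-- The mean-field map `p ↦ z_π(p) + p` is a uniform contraction on the price box. -/
lemma MeanFieldRegular.exists_lt_one [IsProbabilityMeasure Θ] (h : M.MeanFieldRegular Θ π l u)
    (hπ₀ : 0 ≤ π) (hπ₁ : π ≤ 1)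
    (hZ : SmoothFamily M.excessOf (priceBox l u δ) C)
    (hD : ∀ w, SmoothFamily (fun g => M.demand g w) (priceBox l u δ) C)
    (hS : ∀ w, SmoothFamily (fun g => M.supply g w) (priceBox l u δ) C) (hδ : 0 < δ) :
    ∃ K < 1, ∀ p ∈ priceBox l u 0,
      ‖∫ x, fderiv ℝ (M.excessOf x) p ∂Θ.prod (treatmentLaw π) + .id ℝ (Price J)‖ ≤ K := by
  have := isProbabilityMeasure_treatmentLaw hπ₀ hπ₁
  set D : Price J → (Price J →L[ℝ] Price J) := fun p =>
    ∫ x, fderiv ℝ (M.excessOf x) p ∂Θ.prod (treatmentLaw π) + .id ℝ (Price J) with hDdef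
  have hsub : priceBox l u 0 ⊆ priceBox l u δ := priceBox_mono hδ.le
  have hlt : ∀ p ∈ priceBox l u 0, ‖D p‖ < 1 := fun p hp => by
    have h1 := (hasFDerivAt_meanExcess (Θ := Θ) hπ₀ hπ₁ hZ hD hS hδ hp).fun_add (hasFDerivAt_id p)
    have h2 := h.contraction p hp
    rwa [show (fun q => M.meanExcess Θ π q + q) = fun q => M.meanExcess Θ π q + id q from rfl,
      h1.fderiv] at h2
  have hcont : ContinuousOn D (priceBox l u 0) := by
    have : LipschitzOnWith C.toNNReal D (priceBox l u 0) := by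
      refine LipschitzOnWith.of_dist_le_mul fun p hp q hq => ?_
      rw [dist_eq_norm, dist_eq_norm, hDdef, add_sub_add_right_eq_sub]
      refine (hZ.norm_integral_fderiv_sub_le (hsub hp) (hsub hq)).trans ?_
      gcongr
      exact Real.le_coe_toNNReal C
    exact this.continuousOn
  rcases (priceBox l u 0).eq_empty_or_nonempty with hemp | hne
  · exact ⟨0, by norm_num, by simp [hemp]⟩
  -- The pointwise strict bound becomes uniform because the continuous norm attains its maximum on
  -- the compact box.
  · obtain ⟨p, hp, hmax⟩ := isCompact_priceBox.exists_isMaxOn hne hcont.norm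
    exact ⟨‖D p‖, hlt p hp, fun q hq => hmax hq⟩

/-- The choke-price inequalities integrate to the sign conditions on the faces, which gives
existence; the contraction gives uniqueness. -/
theorem existsUnique_isMeanFieldPrice [IsProbabilityMeasure Θ]
    (hb : M.PricesBounded Θ l u) (h : M.MeanFieldRegular Θ π l u) (hπ₀ : 0 ≤ π) (hπ₁ : π ≤ 1)
    (hZ : SmoothFamily M.excessOf (priceBox l u δ) C)
    (hD : ∀ w, SmoothFamily (fun g => M.demand g w) (priceBox l u δ) C)
    (hS : ∀ w, SmoothFamily (fun g => M.supply g w) (priceBox l u δ) C) (hδ : 0 < δ) :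
    ∃! p, M.IsMeanFieldPrice Θ π l u p := by
  have := isProbabilityMeasure_treatmentLaw hπ₀ hπ₁
  obtain ⟨K, hK1, hK⟩ := h.exists_lt_one hπ₀ hπ₁ hZ hD hS hδ
  have hcontr : ∀ p ∈ priceBox l u 0, ∀ q ∈ priceBox l u 0,
      ‖(M.meanExcess Θ π p + p) - (M.meanExcess Θ π q + q)‖ ≤ K * ‖p - q‖ := fun p hp q hq =>
    (convex_priceBox (l := l) (u := u)).norm_image_sub_le_of_norm_hasFDerivWithin_le (𝕜 := ℝ)
      (f := fun p => M.meanExcess Θ π p + p)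
      (fun r hr => ((hasFDerivAt_meanExcess hπ₀ hπ₁ hZ hD hS hδ hr).fun_add
        (hasFDerivAt_id r)).hasFDerivWithinAt) hK hq hp
  have happly : ∀ p ∈ priceBox l u 0, ∀ j,
      M.meanExcess Θ π p j = ∫ x, M.excessOf x p j ∂Θ.prod (treatmentLaw π) := fun p hp j => by
    have hp' := priceBox_mono hδ.le hp
    rw [meanExcess_eq_integral hπ₀ hπ₁ hZ hD hS hp']
    exact ((EuclideanSpace.proj j : Price J →L[ℝ] ℝ).integral_comp_comm (hZ.integrable hp')).symm
  obtain ⟨p, hp, hp0⟩ := exists_zero_of_contraction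
    (fun j => by linarith [hb.lower_lt_upper j]) hK1 hcontr
    (fun p hp j hj => by
      rw [happly p hp]
      exact integral_nonpos fun x => hb.upper _ _ _ _ (by rw [hj]; simp))
    (fun p hp j hj => by
      rw [happly p hp]
      exact integral_nonneg fun x => hb.lower _ _ _ _ (by rw [hj]; simp))
  refine ⟨p, ⟨hp, hp0⟩, fun q hq => ?_⟩
  have h1 := norm_sub_le_of_contraction hcontr hq.1 hp
  rw [hq.2, hp0, sub_zero, norm_zero] at h1
  have h2 : ‖q - p‖ = 0 := le_antisymm (by
    by_contra! h3
    nlinarith) (norm_nonneg _)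
  exact sub_eq_zero.1 (norm_eq_zero.1 h2)

/-- If the perturbed average excess demand is a contraction plus `-id` on the enlarged box and the
sample contains individuals with strict choke prices, then any clearing price clears the market
exactly and lies in the enlarged box. -/
lemma IsClearingPrice.mem_priceBox_and_eq_zero (hb : M.PricesBounded Θ l u) {n : ℕ}
    {g : Fin n → 𝒢} {W : Fin n → Bool} {U : Fin n → Price J} {P : Price J}
    (hP : M.IsClearingPrice g W U P) {η K : ℝ} (hη : 0 ≤ η) (hU : ∀ i j, |U i j| ≤ η) (hK : K < 1)
    (hcontr : ∀ p ∈ priceBox l u η, ∀ q ∈ priceBox l u η,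
      ‖(M.avgExcess g W U p + p) - (M.avgExcess g W U q + q)‖ ≤ K * ‖p - q‖)
    (hup : ∀ j, ∃ i, ∀ p : Price J, u j ≤ p j → M.excess (g i) (W i) p j < 0)
    (hlow : ∀ j, ∃ i, ∀ p : Price J, p j ≤ l j → 0 < M.excess (g i) (W i) p j) :
    P ∈ priceBox l u η ∧ M.avgExcess g W U P = 0 := by
  have happly : ∀ p j, M.avgExcess g W U p j =
      (n : ℝ)⁻¹ * ∑ i, M.excess (g i) (W i) (p + U i) j := fun p j => average_apply _ j
  have hge : ∀ (p : Price J) j, u j + η ≤ p j → ∀ i, u j ≤ (p + U i) j := fun p j hj i => by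
    have := (abs_le.1 (hU i j)).1
    simp only [PiLp.add_apply]; linarith
  have hle : ∀ (p : Price J) j, p j ≤ l j - η → ∀ i, (p + U i) j ≤ l j := fun p j hj i => by
    have := (abs_le.1 (hU i j)).2
    simp only [PiLp.add_apply]; linarith
  obtain ⟨q, -, hq⟩ := exists_zero_of_contraction
    (fun j => by linarith [hb.lower_lt_upper j]) hK hcontr
    (fun p _ j hj => by
      rw [happly]
      exact mul_nonpos_of_nonneg_of_nonpos (by positivity)
        (Finset.sum_nonpos fun i _ => hb.upper _ _ _ _ (hge p j hj.ge i)))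
    (fun p _ j hj => by
      rw [happly]
      exact mul_nonneg (by positivity)
        (Finset.sum_nonneg fun i _ => hb.lower _ _ _ _ (hle p j hj.le i)))
  have h0 : M.avgExcess g W U P = 0 := by
    have := hP q
    rwa [hq, norm_zero, norm_le_zero_iff] at this
  have hj0 : ∀ j, (n : ℝ)⁻¹ * ∑ i, M.excess (g i) (W i) (P + U i) j = 0 := fun j => by
    rw [← happly, h0]; rfl
  -- Outside the enlarged box some coordinate stays beyond its choke price for every perturbed
  -- individual. All summands then have one sign and one is strict, so the average cannot vanish.
  refine ⟨fun j => ⟨?_, ?_⟩, h0⟩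
  · by_contra! hcon
    obtain ⟨i, hi⟩ := hlow j
    have hn : (0 : ℝ) < n := by exact_mod_cast i.pos
    have : 0 < ∑ i, M.excess (g i) (W i) (P + U i) j :=
      Finset.sum_pos' (fun k _ => hb.lower _ _ _ _ (hle P j hcon.le k))
        ⟨i, Finset.mem_univ i, hi _ (hle P j hcon.le i)⟩
    exact absurd (hj0 j) (mul_pos (inv_pos.2 hn) this).ne'
  · by_contra! hcon
    obtain ⟨i, hi⟩ := hup j
    have hn : (0 : ℝ) < n := by exact_mod_cast i.pos
    have : ∑ i, M.excess (g i) (W i) (P + U i) j < 0 :=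
      Finset.sum_neg' (fun k _ => hb.upper _ _ _ _ (hge P j hcon.le k))
        ⟨i, Finset.mem_univ i, hi _ (hge P j hcon.le i)⟩
    exact absurd (hj0 j) (mul_neg_of_pos_of_neg (inv_pos.2 hn) this).ne

/-- The estimator is an average of weighted outcomes. -/
lemma adeEstimator_eq_average (M : Market 𝒢 J) (π : ℝ) {n : ℕ} (g : Fin n → 𝒢) (W : Fin n → Bool)
    (U : Fin n → Price J) (P : Price J) :
    M.adeEstimator π g W U P =
      (n : ℝ)⁻¹ • ∑ i, M.weightedOutcome π (g i, W i) (P + U i) := by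
  simp only [adeEstimator, weightedOutcome, smul_eq_mul]
  congr 1
  refine Finset.sum_congr rfl fun i _ => ?_
  cases W i <;> simp [div_eq_inv_mul]

/-- The influence function of the estimator. -/
noncomputable def influence (M : Market 𝒢 J) (Θ : Measure 𝒢) (π : ℝ) (p : Price J)
    (x : 𝒢 × Bool) : ℝ :=
  M.weightedOutcome π x p - M.priceCorrection Θ π p (M.excessOf x p)

/-- For a fixed type, the treated-minus-control difference of the influence function is `R` and its
mean over the treatment is `T`, so this is the law of total variance. -/
lemma sigmaSqD_eq_variance [IsProbabilityMeasure Θ] (hπ₀ : 0 < π) (hπ₁ : π < 1) {p : Price J}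
    {b : ℝ} (hm : Measurable (M.influence Θ π p)) (hb : ∀ x, |M.influence Θ π p x| ≤ b) :
    variance (M.influence Θ π p) (Θ.prod (treatmentLaw π)) = M.sigmaSqD Θ π p := by
  have hπ₂ : 1 - π ≠ 0 := (sub_pos.2 hπ₁).ne'
  have hπ₃ : π ≠ 0 := hπ₀.ne'
  rw [variance_prod_treatmentLaw hπ₀.le hπ₁.le hm hb, sigmaSqD]
  congr 2
  · congr 1 with g
    simp only [influence, weightedOutcome, excessOf, varR, map_sub, if_true, Bool.false_eq_true,
      if_false, smul_eq_mul]
    ring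
  · funext g
    simp only [influence, weightedOutcome, excessOf, varT, map_add, map_smul, if_true,
      Bool.false_eq_true, if_false, smul_eq_mul]
    field_simp
    ring

end Market

/-- Reduces vector averages to coordinates, to which the scalar Chebyshev bounds apply. -/
lemma norm_le_sum_abs_apply {J : ℕ} (v : Price J) : ‖v‖ ≤ ∑ j, |v j| := by
  have h := clm_apply_eq_sum (.id ℝ (Price J)) v
  rw [ContinuousLinearMap.id_apply] at h
  conv_lhs => rw [h]
  refine (norm_sum_le _ _).trans_eq ?_
  simp [norm_smul]

lemma aemeasurable_average {Ω E : Type*} [MeasurableSpace Ω] {μ : Measure Ω}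
    [NormedAddCommGroup E] [NormedSpace ℝ E] [MeasurableSpace E] [BorelSpace E]
    [SecondCountableTopology E] {n : ℕ} {f : Fin n → Ω → E} (hf : ∀ i, AEMeasurable (f i) μ) :
    AEMeasurable (fun ω => (n : ℝ)⁻¹ • ∑ i, f i ω) μ :=
  (Finset.aemeasurable_fun_sum _ fun i _ => hf i).const_smul _

/-! ### Stochastic bounds and clearing in large samples -/

namespace Market.IsExperiment

variable {𝒢 : Type*} [MeasurableSpace 𝒢] {J : ℕ} {Θ : Measure 𝒢} [IsProbabilityMeasure Θ] {π : ℝ}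
  {Ω : Type*} [MeasurableSpace Ω] {μ : Measure Ω} [IsProbabilityMeasure μ]
  {h : ℕ → ℝ} {g : ℕ → Ω → 𝒢} {W : ℕ → Ω → Bool} {U : (n : ℕ) → Fin n → Ω → Price J}
  [IsProbabilityMeasure (treatmentLaw π)] {M : Market 𝒢 J} {l u : Price J} {δ C : ℝ}

/-- Normalized averages of a centred bounded function of type and treatment are bounded in
probability. -/
lemma measure_abs_sqrt_mul_average_type_ge_le (hexp : Market.IsExperiment J μ Θ π h g W U)
    {φ : 𝒢 × Bool → ℝ} (hφ : Measurable φ) {b : ℝ} (hb : ∀ x, |φ x| ≤ b)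
    (h0 : ∫ x, φ x ∂Θ.prod (treatmentLaw π) = 0) (n : ℕ) (c : ℝ) (hc : 0 < c) :
    μ {ω | c ≤ |√(n : ℝ) * ((n : ℝ)⁻¹ * ∑ i : Fin n, φ (g i ω, W i ω))|}
      ≤ ENNReal.ofReal (b ^ 2 / c ^ 2) := by
  have hmp : MeasurePreserving (Prod.map id Prod.fst)
      (Θ.prod ((treatmentLaw π).prod (perturbationLaw J (h n)))) (Θ.prod (treatmentLaw π)) :=
    (MeasurePreserving.id Θ).prod measurePreserving_fst
  refine hexp.measure_abs_sqrt_mul_average_ge_le n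
    (ψ := fun t => φ (t.1, t.2.1)) (by fun_prop) (ae_of_all _ fun t => hb _) ?_ hc
  have h1 := hmp.hasLaw.integral_comp hφ.aestronglyMeasurable
  exact h1.trans h0

/-- Normalized averages that are linear in the perturbations vanish in probability. -/
lemma tendstoInMeasure_sqrt_mul_average_perturbation
    (hexp : Market.IsExperiment J μ Θ π h g W U) (hh : Tendsto h atTop (𝓝 0))
    {φ : 𝒢 × Bool → Price J →L[ℝ] ℝ} (hφ : Measurable φ) {b : ℝ} (hb : ∀ x, ‖φ x‖ ≤ b) :
    TendstoInMeasure μ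
      (fun (n : ℕ) ω => √(n : ℝ) * ((n : ℝ)⁻¹ * ∑ i : Fin n, φ (g i ω, W i ω) (U n i ω))) atTop 0 := by
  have happ : Measurable fun q : (Price J →L[ℝ] ℝ) × Price J => q.1 q.2 :=
    isBoundedBilinearMap_apply.continuous.measurable
  have hψ : Measurable fun t : 𝒢 × Bool × Price J => φ (t.1, t.2.1) t.2.2 :=
    happ.comp (f := fun t : 𝒢 × Bool × Price J => (φ (t.1, t.2.1), t.2.2)) (by fun_prop)
  have hbound : ∀ x (v : Price J) n, (∀ j, |v j| ≤ |h n|) → |φ x v| ≤ b * (√J * |h n|) :=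
    fun x v n hv => ((φ x).le_opNorm v).trans (mul_le_mul (hb x)
      (norm_le_sqrt_mul_of_abs_le (abs_nonneg _) hv) (norm_nonneg _)
      ((norm_nonneg _).trans (hb x)))
  refine TendstoInMeasure.zero_of_measure_le
    (f := fun n ε => ENNReal.ofReal ((b * (√J * |h n|)) ^ 2 / ε ^ 2)) (fun ε hε => ?_)
    fun ε hε n => hexp.measure_abs_sqrt_mul_average_ge_le n hψ ?_ ?_ hε
  · have : Tendsto (fun n => (b * (√J * |h n|)) ^ 2 / ε ^ 2) atTop
        (𝓝 ((b * (√J * |(0 : ℝ)|)) ^ 2 / ε ^ 2)) :=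
      (((hh.abs.const_mul _).const_mul _).pow 2).div_const _
    simpa using ENNReal.tendsto_ofReal this
  · have hq : Measure.QuasiMeasurePreserving (fun t : 𝒢 × Bool × Price J => t.2.2)
        (Θ.prod ((treatmentLaw π).prod (perturbationLaw J (h n)))) (perturbationLaw J (h n)) :=
      (measurePreserving_snd.comp measurePreserving_snd).quasiMeasurePreserving
    filter_upwards [hq.ae (ae_perturbationLaw_abs_le (h n))] with t ht using hbound _ _ n ht
  · have hq : ∀ᵐ t ∂(treatmentLaw π).prod (perturbationLaw J (h n)), ∀ j, |t.2 j| ≤ |h n| :=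
      (measurePreserving_snd.quasiMeasurePreserving).ae (ae_perturbationLaw_abs_le (h n))
    have hq' : ∀ᵐ t ∂Θ.prod ((treatmentLaw π).prod (perturbationLaw J (h n))),
        ∀ j, |t.2.2 j| ≤ |h n| := (measurePreserving_snd.quasiMeasurePreserving).ae hq
    -- By Fubini the perturbation is integrated first, with type and treatment fixed; a linear
    -- functional of it has mean zero.
    rw [integral_prod _ (.of_bound hψ.aestronglyMeasurable (b * (√J * |h n|)) (by
      filter_upwards [hq'] with t ht using hbound _ _ n ht))]
    refine integral_eq_zero_of_ae (ae_of_all _ fun y => ?_)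
    simp only [Pi.zero_apply]
    rw [integral_prod]
    · exact integral_eq_zero_of_ae (ae_of_all _ fun w => integral_perturbationLaw_clm (h n) (φ (y, w)))
    · refine .of_bound (hψ.comp measurable_prodMk_left).aestronglyMeasurable (b * (√J * |h n|)) ?_
      filter_upwards [hq] with t ht using hbound _ _ n ht

/-- Almost surely, in large samples, the map `p ↦ p + (1/n) ∑ᵢ Zᵢ(Wᵢ, p + Uᵢ)` is a contraction on
the price box enlarged by the size of the perturbations. -/
lemma exists_ae_eventually_contraction (hexp : Market.IsExperiment J μ Θ π h g W U)
    (hh : Tendsto h atTop (𝓝 0)) (hlu : ∀ j, l j ≤ u j) (hδ : 0 < δ) (hC : 0 ≤ C)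
    (hZ : SmoothFamily M.excessOf (priceBox l u δ) C) {K : ℝ} (hK1 : K < 1)
    (hK : ∀ p ∈ priceBox l u 0,
      ‖∫ x, fderiv ℝ (M.excessOf x) p ∂Θ.prod (treatmentLaw π) + .id ℝ (Price J)‖ ≤ K) :
    ∃ K' < 1, ∀ᵐ ω ∂μ, ∀ᶠ n : ℕ in atTop,
      ∀ p ∈ priceBox l u |h n|, ∀ q ∈ priceBox l u |h n|,
        ‖(M.avgExcess (fun i : Fin n => g i ω) (fun i => W i ω) (fun i => U n i ω) p + p)
          - (M.avgExcess (fun i : Fin n => g i ω) (fun i => W i ω) (fun i => U n i ω) q + q)‖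
          ≤ K' * ‖p - q‖ := by
  -- Three errors of size `ε` are spent: the law of large numbers on the net, the mesh `C * r`, and
  -- the perturbations. The resulting constant `K + 3 * ε` is still below `1`.
  set ε := (1 - K) / 4 with hε
  have hε0 : 0 < ε := by linarith
  set r := ε / (C + 1) with hr
  have hr0 : 0 < r := by positivity
  have hCr : C * r ≤ ε := by
    rw [hr, mul_div_assoc', div_le_iff₀ (by positivity)]; nlinarith
  obtain ⟨t, htS, htfin, htcov⟩ :=
    (isCompact_priceBox (l := l) (u := u) (δ := 0)).finite_cover_balls hr0
  have hcov : ∀ p ∈ priceBox l u 0, ∃ q ∈ t, ‖p - q‖ ≤ r := fun p hp => by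
    obtain ⟨q, hq, hpq⟩ := Set.mem_iUnion₂.1 (htcov hp)
    exact ⟨q, hq, by rw [← dist_eq_norm]; exact (Metric.mem_ball.1 hpq).le⟩
  have hnet : ∀ᵐ ω ∂μ, ∀ q ∈ t, Tendsto
      (fun n : ℕ => (n : ℝ)⁻¹ • ∑ i : Fin n, fderiv ℝ (M.excessOf (g i ω, W i ω)) q) atTop
      (𝓝 (∫ x, fderiv ℝ (M.excessOf x) q ∂Θ.prod (treatmentLaw π))) := by
    rw [ae_ball_iff htfin.countable]
    intro q hq
    have hqδ := priceBox_mono hδ.le (htS hq)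
    exact hexp.ae_tendsto_average (hZ.measurable_fderiv hqδ) fun x => hZ.norm_fderiv_le x q hqδ
  refine ⟨K + 3 * ε, by linarith, ?_⟩
  filter_upwards [hnet, hexp.ae_abs_perturbation_le] with ω hω hU
  have h1 : ∀ᶠ n : ℕ in atTop, ∀ q ∈ t,
      ‖(n : ℝ)⁻¹ • ∑ i : Fin n, fderiv ℝ (M.excessOf (g i ω, W i ω)) q + .id ℝ (Price J)‖
        ≤ K + ε := by
    rw [htfin.eventually_all]
    intro q hq
    have h2 := ((hω q hq).add_const (.id ℝ (Price J))).norm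
    exact ((tendsto_order.1 h2).2 (K + ε) (by linarith [hK q (htS hq)])).mono fun n hn => hn.le
  have habs : Tendsto (fun n => |h n|) atTop (𝓝 0) := by simpa using hh.abs
  have h3 : ∀ᶠ n in atTop, 2 * |h n| ≤ δ := by
    have := habs.const_mul 2
    rw [mul_zero] at this
    exact ((tendsto_order.1 this).2 δ hδ).mono fun n hn => hn.le
  have h4 : ∀ᶠ n in atTop, C * (2 * (√J * |h n|)) ≤ ε := by
    have := ((habs.const_mul √J).const_mul 2).const_mul C
    simp only [mul_zero] at this
    exact ((tendsto_order.1 this).2 ε hε0).mono fun n hn => hn.le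
  filter_upwards [h1, h3, h4] with n hn1 hn3 hn4 p hp q hq
  have := hZ.norm_average_add_sub_le hC hlu (abs_nonneg _) hn3 (hU n) htS hcov hn1 hp hq
  refine this.trans (mul_le_mul_of_nonneg_right ?_ (norm_nonneg _))
  linarith [mul_add C r (2 * (√J * |h n|))]

/-- Almost surely, in large samples, the clearing price clears the market exactly and lies in the
enlarged price box. -/
lemma ae_eventually_clears (hexp : Market.IsExperiment J μ Θ π h g W U) (hπ₀ : 0 < π)
    (hb : M.PricesBounded Θ l u) {P : ℕ → Ω → Price J}
    (hP : ∀ n, ∀ᵐ ω ∂μ, M.IsClearingPrice (fun i : Fin n => g i ω) (fun i : Fin n => W i ω)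
      (fun i : Fin n => U n i ω) (P n ω)) {K : ℝ} (hK1 : K < 1)
    (hK : ∀ᵐ ω ∂μ, ∀ᶠ n : ℕ in atTop,
      ∀ p ∈ priceBox l u |h n|, ∀ q ∈ priceBox l u |h n|,
        ‖(M.avgExcess (fun i : Fin n => g i ω) (fun i => W i ω) (fun i => U n i ω) p + p)
          - (M.avgExcess (fun i : Fin n => g i ω) (fun i => W i ω) (fun i => U n i ω) q + q)‖
          ≤ K * ‖p - q‖) :
    ∀ᵐ ω ∂μ, ∀ᶠ n : ℕ in atTop, P n ω ∈ priceBox l u |h n| ∧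
      M.avgExcess (fun i : Fin n => g i ω) (fun i => W i ω) (fun i => U n i ω) (P n ω) = 0 := by
  have hup : ∀ᵐ ω ∂μ, ∀ j, ∀ᶠ n : ℕ in atTop, ∃ i : Fin n, ∀ p : Price J, u j ≤ p j →
      M.excess (g i ω) (W i ω) p j < 0 := by
    rw [ae_all_iff]
    intro j
    obtain ⟨A, hA, hpos, hlt⟩ := hb.upper_strict true j
    filter_upwards [hexp.ae_eventually_exists_mem hπ₀ hA hpos] with ω hω
    filter_upwards [hω] with n ⟨i, hi, hw⟩
    exact ⟨i, fun p hp => by rw [hw]; exact hlt _ hi p hp⟩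
  have hlow : ∀ᵐ ω ∂μ, ∀ j, ∀ᶠ n : ℕ in atTop, ∃ i : Fin n, ∀ p : Price J, p j ≤ l j →
      0 < M.excess (g i ω) (W i ω) p j := by
    rw [ae_all_iff]
    intro j
    obtain ⟨A, hA, hpos, hlt⟩ := hb.lower_strict true j
    filter_upwards [hexp.ae_eventually_exists_mem hπ₀ hA hpos] with ω hω
    filter_upwards [hω] with n ⟨i, hi, hw⟩
    exact ⟨i, fun p hp => by rw [hw]; exact hlt _ hi p hp⟩
  filter_upwards [hup, hlow, hK, ae_all_iff.2 hP, hexp.ae_abs_perturbation_le]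
    with ω h1 h2 h3 h4 h5
  filter_upwards [eventually_all.2 h1, eventually_all.2 h2, h3] with n hn1 hn2 hn3
  exact (h4 n).mem_priceBox_and_eq_zero hb (abs_nonneg _) (h5 n) hK1 hn3 hn1 hn2

end Market.IsExperiment

/-! ### Asymptotic linearity of the estimator -/

/-- Combining a linear bound on the price deviation with the linearized remainder. -/
lemma remainder_le_of_deviation_le {L s q e θ κ C' Δ q' R : ℝ} (hs : 0 ≤ s) (hq : 0 ≤ q) (he : 0 ≤ e)
    (hL : 0 ≤ L) (hκ : 0 ≤ κ) (hC : 0 ≤ C') (hθ : 0 ≤ θ) (hΔ0 : 0 ≤ Δ)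
    (hΔ : Δ ≤ L * (s + q + C' * e))
    (hT : θ + (1 + κ) * C' * (L * (s + q + C' * e)) ≤ 1)
    (hR : R ≤ θ * Δ + q' + κ * q + (1 + κ) * (C' * (Δ ^ 2 + e))) :
    R ≤ L * ((θ + (1 + κ) * C' * (L * (s + q + C' * e))) * s) + (L + κ) * q + q'
      + (L * C' + (1 + κ) * C') * e := by
  set b := L * (s + q + C' * e)
  have hb : 0 ≤ b := by positivity
  -- The terms in `Δ` and `Δ ^ 2` are together at most `T * b`. In `b` the factor `T` is kept on
  -- `s`, which is only of order `n^{-1/2}`, and is replaced by `1` on `q` and `e`, which are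
  -- already negligible.
  set T := θ + (1 + κ) * C' * b with hTdef
  have h1 : θ * Δ ≤ θ * b := by gcongr
  have h2 : Δ ^ 2 ≤ b * b := by rw [pow_two]; gcongr
  have h3 : (1 + κ) * (C' * (Δ ^ 2 + e)) ≤ (1 + κ) * (C' * (b * b + e)) := by gcongr
  have h4 : T * (L * (q + C' * e)) ≤ 1 * (L * (q + C' * e)) := by gcongr
  have h5 : θ * b + (1 + κ) * (C' * (b * b + e)) = T * b + (1 + κ) * C' * e := by
    rw [hTdef]; ring
  have h6 : T * b = L * (T * s) + T * (L * (q + C' * e)) := by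
    simp only [b]; ring
  nlinarith

namespace Market

variable {𝒢 : Type*} [MeasurableSpace 𝒢] {J : ℕ} {Θ : Measure 𝒢} [IsProbabilityMeasure Θ] {π : ℝ}
  {Ω : Type*} [MeasurableSpace Ω] {μ : Measure Ω} [IsProbabilityMeasure μ]
  {h : ℕ → ℝ} {g : ℕ → Ω → 𝒢} {W : ℕ → Ω → Bool} {U : (n : ℕ) → Fin n → Ω → Price J}
  {M : Market 𝒢 J} {l u : Price J} {δ C : ℝ}

set_option maxHeartbeats 1000000 in
/-- The estimator is asymptotically linear with influence function `influence`. -/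
lemma tendstoInMeasure_adeEstimator_sub_average_influence
    (hπ₀ : 0 < π) (hπ₁ : π < 1)
    (hexp : Market.IsExperiment J μ Θ π h g W U)
    (hh : Tendsto h atTop (𝓝 0)) (hh2 : Tendsto (fun n : ℕ => √(n : ℝ) * |h n| ^ 2) atTop (𝓝 0))
    (hb : M.PricesBounded Θ l u) (hreg : M.MeanFieldRegular Θ π l u) (hδ : 0 < δ) (hC : 0 ≤ C)
    (hZ : SmoothFamily M.excessOf (priceBox l u δ) C)
    (hF : SmoothFamily (M.weightedOutcome π) (priceBox l u δ) C)
    (hY : ∀ w, SmoothFamily (fun g => M.outcome g w) (priceBox l u δ) C)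
    (hD : ∀ w, SmoothFamily (fun g => M.demand g w) (priceBox l u δ) C)
    (hS : ∀ w, SmoothFamily (fun g => M.supply g w) (priceBox l u δ) C)
    {P : ℕ → Ω → Price J}
    (hP : ∀ n, ∀ᵐ ω ∂μ, M.IsClearingPrice (fun i : Fin n => g i ω) (fun i : Fin n => W i ω)
      (fun i : Fin n => U n i ω) (P n ω))
    (hm : ∀ n, AEMeasurable (fun ω => M.adeEstimator π (fun i : Fin n => g i ω)
      (fun i : Fin n => W i ω) (fun i : Fin n => U n i ω) (P n ω)) μ)
    {p : Price J} (hp : M.IsMeanFieldPrice Θ π l u p) :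
    TendstoInMeasure μ (fun (n : ℕ) ω => √(n : ℝ) *
      (M.adeEstimator π (fun i : Fin n => g i ω) (fun i : Fin n => W i ω)
        (fun i : Fin n => U n i ω) (P n ω)
        - (n : ℝ)⁻¹ * ∑ i : Fin n, M.influence Θ π p (g i ω, W i ω))) atTop 0 := by
  have := isProbabilityMeasure_treatmentLaw hπ₀.le hπ₁.le
  obtain ⟨hpS, hp0⟩ := hp
  have hpδ : p ∈ priceBox l u δ := priceBox_mono hδ.le hpS
  set ν := Θ.prod (treatmentLaw π) with hν
  set H : Price J →L[ℝ] Price J := ∫ x, fderiv ℝ (M.excessOf x) p ∂ν with hHdef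
  set a : Price J →L[ℝ] ℝ := ∫ x, fderiv ℝ (M.weightedOutcome π x) p ∂ν with hadef
  have hHjac : M.jacobian Θ π p = H :=
    (hasFDerivAt_meanExcess hπ₀.le hπ₁.le hZ hD hS hδ hpS).fderiv
  have hcorr : M.priceCorrection Θ π p = a.comp H.inverse := by
    rw [priceCorrection, hHjac, (hasFDerivAt_adeLimit hπ₀ hπ₁ hF hY hδ hpS).fderiv]
  have hHinv : ∀ v, H.inverse (H v) = v := fun v => by
    have := hreg.jacobian_invertible p ⟨hpS, hp0⟩
    rw [hHjac] at this
    exact this.inverse_apply_self v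
  set κ := ‖a.comp H.inverse‖ with hκ
  have hκ0 : 0 ≤ κ := norm_nonneg _
  obtain ⟨K₀, hK₀1, hK₀⟩ := hreg.exists_lt_one hπ₀.le hπ₁.le hZ hD hS hδ
  obtain ⟨K, hK1, hK⟩ := hexp.exists_ae_eventually_contraction hh
    (fun j => (hb.lower_lt_upper j).le) hδ hC hZ hK₀1 hK₀
  have hclear := hexp.ae_eventually_clears hπ₀ hb hP hK1 hK
  set L := (1 - K)⁻¹ with hLdef
  have hL : 0 ≤ L := inv_nonneg.2 (by linarith)
  -- the averages entering the expansion
  set S : ℕ → Ω → Price J := fun n ω => (n : ℝ)⁻¹ • ∑ i : Fin n, M.excessOf (g i ω, W i ω) p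
    with hSdef
  set Q : ℕ → Ω → Price J := fun n ω =>
    (n : ℝ)⁻¹ • ∑ i : Fin n, fderiv ℝ (M.excessOf (g i ω, W i ω)) p (U n i ω) with hQdef
  set A : ℕ → Ω → Price J →L[ℝ] Price J := fun n ω =>
    (n : ℝ)⁻¹ • ∑ i : Fin n, fderiv ℝ (M.excessOf (g i ω, W i ω)) p with hAdef
  set Q' : ℕ → Ω → ℝ := fun n ω =>
    (n : ℝ)⁻¹ • ∑ i : Fin n, fderiv ℝ (M.weightedOutcome π (g i ω, W i ω)) p (U n i ω) with hQ'def
  set A' : ℕ → Ω → Price J →L[ℝ] ℝ := fun n ω =>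
    (n : ℝ)⁻¹ • ∑ i : Fin n, fderiv ℝ (M.weightedOutcome π (g i ω, W i ω)) p with hA'def
  set e : ℕ → ℝ := fun n => J * |h n| ^ 2 with hedef
  set C' := 2 * C with hC'
  set θ : ℕ → Ω → ℝ := fun n ω => ‖A' n ω - a‖ + κ * ‖A n ω - H‖ with hθdef
  set T : ℕ → Ω → ℝ := fun n ω =>
    θ n ω + (1 + κ) * C' * (L * (‖S n ω‖ + ‖Q n ω‖ + C' * e n)) with hTdef
  -- The majorant for `√n` times the error, with norms replaced by sums over coordinates.
  set D : ℕ → Ω → ℝ := fun n ω =>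
    L * ∑ k, |T n ω * (√(n : ℝ) * S n ω k)| + (L + κ) * ∑ k, |√(n : ℝ) * Q n ω k|
      + |√(n : ℝ) * Q' n ω| + (L * C' + (1 + κ) * C') * (√(n : ℝ) * e n) with hDdef
  have hZm := hZ.measurable_fderiv hpδ
  have hFm := hF.measurable_fderiv hpδ
  have hx : ∀ i, AEMeasurable (fun ω => (g i ω, W i ω)) μ := fun i =>
    (hexp.hasLaw_type_treatment i).aemeasurable
  have hUm : ∀ n i, AEMeasurable (U n i) μ := fun n i => (hexp.hasLaw_perturbation n i).aemeasurable
  have hSm : ∀ n, AEMeasurable (S n) μ := fun n =>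
    aemeasurable_average fun i => (hZ.measurable p).comp_aemeasurable (hx i)
  have hAm : ∀ n, AEMeasurable (A n) μ := fun n =>
    aemeasurable_average fun i => hZm.comp_aemeasurable (hx i)
  have hA'm : ∀ n, AEMeasurable (A' n) μ := fun n =>
    aemeasurable_average fun i => hFm.comp_aemeasurable (hx i)
  have hQm : ∀ n, AEMeasurable (Q n) μ := fun n => aemeasurable_average fun i =>
    (isBoundedBilinearMap_apply (𝕜 := ℝ) (E := Price J) (F := Price J)).continuous.measurable
      |>.comp_aemeasurable ((hZm.comp_aemeasurable (hx i)).prodMk (hUm n i))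
  have hQ'm : ∀ n, AEMeasurable (Q' n) μ := fun n => aemeasurable_average fun i =>
    (isBoundedBilinearMap_apply (𝕜 := ℝ) (E := Price J) (F := ℝ)).continuous.measurable
      |>.comp_aemeasurable ((hFm.comp_aemeasurable (hx i)).prodMk (hUm n i))
  have hTm : ∀ n, AEMeasurable (T n) μ := fun n =>
    (((hA'm n).sub_const a).norm.add (((hAm n).sub_const H).norm.const_mul κ)).add
      (((((hSm n).norm.add (hQm n).norm).add_const _).const_mul L).const_mul _)
  have happm : ∀ {V : Ω → Price J} (k : Fin J), AEMeasurable V μ →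
      AEMeasurable (fun ω => V ω k) μ := fun k hV =>
    (EuclideanSpace.proj k : Price J →L[ℝ] ℝ).continuous.measurable.comp_aemeasurable hV
  have hDm : ∀ n, AEMeasurable (D n) μ := fun n =>
    (((Finset.aemeasurable_fun_sum _ fun k _ =>
      ((hTm n).mul ((happm k (hSm n)).const_mul _)).abs).const_mul L).add
      ((Finset.aemeasurable_fun_sum _ fun k _ =>
        ((happm k (hQm n)).const_mul _).abs).const_mul _)).add
      ((hQ'm n).const_mul _).abs |>.add_const _
  -- limits
  have hmean0 : ∫ x, M.excessOf x p ∂ν = 0 := by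
    rw [← meanExcess_eq_integral hπ₀.le hπ₁.le hZ hD hS hpδ, hp0]
  have he : Tendsto e atTop (𝓝 0) := by
    have h1 : Tendsto e atTop (𝓝 (J * |(0 : ℝ)| ^ 2)) := (hh.abs.pow 2).const_mul (J : ℝ)
    simpa using h1
  -- The law of large numbers handles `A'`, `A` and `S`, the last with limit zero because `p` clears
  -- the mean-field market. For `Q` the crude bound of order `|h n|` suffices here.
  have hT0 : ∀ᵐ ω ∂μ, Tendsto (fun n => T n ω) atTop (𝓝 0) := by
    filter_upwards [hexp.ae_tendsto_average hFm fun x => hF.norm_fderiv_le x p hpδ,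
      hexp.ae_tendsto_average hZm fun x => hZ.norm_fderiv_le x p hpδ,
      hexp.ae_tendsto_average (hZ.measurable p) fun x => hZ.norm_le x p hpδ,
      hexp.ae_abs_perturbation_le] with ω h1 h2 h3 h4
    rw [hmean0] at h3
    have h5 : Tendsto (fun n => ‖Q n ω‖) atTop (𝓝 0) := by
      refine squeeze_zero (fun n => norm_nonneg _) (fun n =>
        hZ.norm_average_fderiv_apply_perturbation_le hC (abs_nonneg _) hδ.le (h4 n) hpS) ?_
      simpa using (hh.abs.const_mul √J).const_mul C
    have h1' : Tendsto (fun n => A' n ω) atTop (𝓝 a) := h1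
    have h2' : Tendsto (fun n => A n ω) atTop (𝓝 H) := h2
    have h3' : Tendsto (fun n => S n ω) atTop (𝓝 0) := h3
    have h6 : Tendsto (fun n => T n ω) atTop (𝓝 (‖a - a‖ + κ * ‖H - H‖
        + (1 + κ) * C' * (L * (‖(0 : Price J)‖ + 0 + C' * 0)))) := ((h1'.sub_const a).norm.add ((h2'.sub_const H).norm.const_mul κ)).add
      (((((h3'.norm).add h5).add (he.const_mul C')).const_mul L).const_mul ((1 + κ) * C'))
    simpa using h6
  have hD0 : TendstoInMeasure μ D atTop 0 := by
    -- Four contributions: `T → 0` times the tight `√n S`; `√n Q` and `√n Q'`, whose variances are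
    -- of order `h²`; and the deterministic `√n h²`.
    refine TendstoInMeasure.zero_add (TendstoInMeasure.zero_add (TendstoInMeasure.zero_add
      (TendstoInMeasure.zero_const_mul (TendstoInMeasure.zero_sum _ fun k _ =>
        TendstoInMeasure.zero_abs (TendstoInMeasure.zero_mul_of_tight (b := C) hTm hT0 ?_)) L)
      (TendstoInMeasure.zero_const_mul (TendstoInMeasure.zero_sum _ fun k _ =>
        TendstoInMeasure.zero_abs ?_) _)) (TendstoInMeasure.zero_abs ?_))
      (TendstoInMeasure.zero_of_tendsto ?_)
    · intro n c hc
      simp only [hSdef, average_apply]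
      refine hexp.measure_abs_sqrt_mul_average_type_ge_le (φ := fun x => M.excessOf x p k)
        ((EuclideanSpace.proj k : Price J →L[ℝ] ℝ).continuous.measurable.comp (hZ.measurable p))
        (fun x => (PiLp.norm_apply_le _ k).trans (hZ.norm_le x p hpδ)) ?_ n c hc
      have := (EuclideanSpace.proj k : Price J →L[ℝ] ℝ).integral_comp_comm
        (hZ.integrable (ν := ν) hpδ)
      rw [hmean0, map_zero] at this
      exact this
    · simp only [hQdef, average_apply]
      refine hexp.tendstoInMeasure_sqrt_mul_average_perturbation hh
        (φ := fun x => (EuclideanSpace.proj k : Price J →L[ℝ] ℝ).comp (fderiv ℝ (M.excessOf x) p))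
        (b := ‖(EuclideanSpace.proj k : Price J →L[ℝ] ℝ)‖ * C) ?_ fun x => ?_
      · exact ((ContinuousLinearMap.compL ℝ (Price J) (Price J) ℝ
          (EuclideanSpace.proj k)).continuous.measurable).comp hZm
      · refine (ContinuousLinearMap.opNorm_comp_le _ _).trans ?_
        gcongr
        exact hZ.norm_fderiv_le x p hpδ
    · simp only [hQ'def, smul_eq_mul]
      exact hexp.tendstoInMeasure_sqrt_mul_average_perturbation hh
        (φ := fun x => fderiv ℝ (M.weightedOutcome π x) p) hFm
        fun x => hF.norm_fderiv_le x p hpδ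
    · have := (hh2.const_mul (J : ℝ)).const_mul (L * C' + (1 + κ) * C')
      simp only [mul_zero] at this
      refine this.congr fun n => ?_
      simp only [hedef]; ring
  have hinflm : Measurable (M.influence Θ π p) :=
    (hF.measurable p).sub ((M.priceCorrection Θ π p).continuous.measurable.comp (hZ.measurable p))
  refine TendstoInMeasure.zero_of_ae_eventually_le (fun n => ?_) hDm hD0 ?_
  · have hav : AEMeasurable (fun ω => (n : ℝ)⁻¹ * ∑ i : Fin n, M.influence Θ π p (g i ω, W i ω))
        μ := aemeasurable_average fun i => hinflm.comp_aemeasurable (hx i)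
    exact ((hm n).sub hav).const_mul _
  have habs : Tendsto (fun n => 2 * |h n|) atTop (𝓝 0) := by simpa using hh.abs.const_mul 2
  filter_upwards [hK, hclear, hT0, hexp.ae_abs_perturbation_le] with ω hω1 hω2 hω3 hU
  filter_upwards [hω1, hω2, (tendsto_order.1 hω3).2 1 one_pos,
    (tendsto_order.1 habs).2 δ hδ] with n hn1 hn2 hn3 hn4
  obtain ⟨hPbox, hPzero⟩ := hn2
  have hpη : p ∈ priceBox l u |h n| := priceBox_mono (abs_nonneg _) hpS
  have hS' := norm_nonneg (S n ω)
  have hQ0 := norm_nonneg (Q n ω)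
  have he0 : 0 ≤ e n := by positivity
  have hC'0 : 0 ≤ C' := by positivity
  have hθ0 : 0 ≤ θ n ω := by positivity
  -- deviation of the price
  have hdev : ‖P n ω - p‖ ≤ L * (‖S n ω‖ + ‖Q n ω‖ + C' * e n) := by
    -- Excess demand vanishes at the market price, so the contraction bounds the deviation by its
    -- value at `p`, namely `S + Q` plus a second-order term.
    have h1 := norm_sub_le_of_contraction hn1 hPbox hpη
    rw [hPzero, zero_sub, norm_neg] at h1
    have h2 := hZ.norm_average_expansion_le (x := fun i : Fin n => (g i ω, W i ω)) hC
      (abs_nonneg _) hn4.le (hU n) hpS hpη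
    rw [sub_self, map_zero, sub_zero, norm_zero, zero_pow two_ne_zero, zero_add] at h2
    rw [hLdef, ← div_eq_inv_mul, le_div_iff₀' (by linarith)]
    refine h1.trans ?_
    set ζ := M.avgExcess (fun i : Fin n => g i ω) (fun i => W i ω) (fun i => U n i ω) p
    have h3 : ζ = S n ω + Q n ω + (ζ - S n ω - Q n ω) := by abel
    rw [h3]
    refine (norm_add₃_le).trans ?_
    gcongr
    exact h2
  -- linearization of market clearing and of the estimator
  set ρ : Price J := -(S n ω + A n ω (P n ω - p) + Q n ω) with hρdef
  -- Because the market clears exactly at `P n ω`, `ρ` is precisely the Taylor remainder of excess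
  -- demand.
  have hρ : ‖ρ‖ ≤ C' * (‖P n ω - p‖ ^ 2 + e n) := by
    have h2 := hZ.norm_average_expansion_le (x := fun i : Fin n => (g i ω, W i ω)) hC
      (abs_nonneg _) hn4.le (hU n) hpS hPbox
    refine le_trans (le_of_eq ?_) h2
    congr 1
    have h3 : (n : ℝ)⁻¹ • ∑ i : Fin n, M.excessOf (g i ω, W i ω) (P n ω + U n i ω) = 0 := hPzero
    rw [h3, hρdef]
    simp only [hSdef, hAdef, hQdef]
    abel
  set τ := M.adeEstimator π (fun i : Fin n => g i ω) (fun i : Fin n => W i ω)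
        (fun i : Fin n => U n i ω) (P n ω) with hτ
  set ρ' : ℝ := τ - (n : ℝ)⁻¹ • ∑ i : Fin n, M.weightedOutcome π (g i ω, W i ω) p
    - A' n ω (P n ω - p) - Q' n ω with hρ'def
  have hρ' : |ρ'| ≤ C' * (‖P n ω - p‖ ^ 2 + e n) := by
    have h2 := hF.norm_average_expansion_le (x := fun i : Fin n => (g i ω, W i ω)) hC
      (abs_nonneg _) hn4.le (hU n) hpS hPbox
    rw [hρ'def, hτ, adeEstimator_eq_average]
    exact h2
  have hlin := abs_linearized_remainder_le (A := A n ω) (A' := A' n ω) (S := S n ω) (Q := Q n ω)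
    (Q' := Q' n ω) (ρ' := ρ') (Δ := P n ω - p) (ρ := ρ) (a := a) hHinv
    (by rw [hρdef]; abel) hκ.ge
  -- Subtracting the influence average adds `aᵀH⁻¹S`, which cancels the leading part of `A' Δ`;
  -- `hlin` bounds what is left.
  have hinfl : τ - (n : ℝ)⁻¹ * ∑ i : Fin n, M.influence Θ π p (g i ω, W i ω) =
      A' n ω (P n ω - p) + Q' n ω + ρ' + a.comp H.inverse (S n ω) := by
    have h1 : a.comp H.inverse (S n ω) =
        (n : ℝ)⁻¹ * ∑ i : Fin n, a.comp H.inverse (M.excessOf (g i ω, W i ω) p) := by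
      simp only [hSdef]
      rw [map_smul, map_sum, smul_eq_mul]
    rw [h1, hρ'def]
    simp only [influence, hcorr, Finset.sum_sub_distrib, smul_eq_mul]
    ring
  have hfinal := remainder_le_of_deviation_le (R := |τ - (n : ℝ)⁻¹ * ∑ i : Fin n,
    M.influence Θ π p (g i ω, W i ω)|) (q' := |Q' n ω|) hS' hQ0 he0 hL hκ0 hC'0 hθ0
    (norm_nonneg _) hdev hn3.le (by
      rw [hinfl]
      refine hlin.trans ?_
      have := mul_le_mul_of_nonneg_left hρ hκ0
      simp only [hθdef]
      linarith)
  have hsq : 0 ≤ √(n : ℝ) := Real.sqrt_nonneg _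
  have hT0' : 0 ≤ T n ω := by positivity
  rw [abs_mul, abs_of_nonneg hsq]
  refine (mul_le_mul_of_nonneg_left hfinal hsq).trans ?_
  have h1 : T n ω * (√(n : ℝ) * ‖S n ω‖) ≤ ∑ k, |T n ω * (√(n : ℝ) * S n ω k)| := by
    simp only [abs_mul, abs_of_nonneg hsq, abs_of_nonneg hT0', ← Finset.mul_sum]
    gcongr
    exact norm_le_sum_abs_apply _
  have h2 : √(n : ℝ) * ‖Q n ω‖ ≤ ∑ k, |√(n : ℝ) * Q n ω k| := by
    simp only [abs_mul, abs_of_nonneg hsq, ← Finset.mul_sum]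
    gcongr
    exact norm_le_sum_abs_apply _
  have h3 : |√(n : ℝ) * Q' n ω| = √(n : ℝ) * |Q' n ω| := by rw [abs_mul, abs_of_nonneg hsq]
  simp only [hDdef]
  rw [h3]
  have h4 := mul_le_mul_of_nonneg_left h1 hL
  have h5 := mul_le_mul_of_nonneg_left h2 (add_nonneg hL hκ0)
  calc √(n : ℝ) * (L * (T n ω * ‖S n ω‖) + (L + κ) * ‖Q n ω‖ + |Q' n ω|
        + (L * C' + (1 + κ) * C') * e n)
      = L * (T n ω * (√(n : ℝ) * ‖S n ω‖)) + (L + κ) * (√(n : ℝ) * ‖Q n ω‖)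
        + √(n : ℝ) * |Q' n ω| + (L * C' + (1 + κ) * C') * (√(n : ℝ) * e n) := by ring
    _ ≤ _ := by linarith

end Market

/-! ### Size of the perturbations and conclusion -/

lemma tendsto_perturbation_size {c α : ℝ} (hα : 0 < α) :
    Tendsto (fun n : ℕ => c * (n : ℝ) ^ (-α)) atTop (𝓝 0) := by
  simpa using ((tendsto_rpow_neg_atTop hα).comp tendsto_natCast_atTop_atTop).const_mul c

/-- The exponent is `1/2 - 2α`, negative exactly when `α > 1/4`; this makes the second-order effect
of the perturbations negligible. -/
lemma tendsto_sqrt_mul_perturbation_size_sq {c α : ℝ} (hα : 1 / 4 < α) :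
    Tendsto (fun n : ℕ => √(n : ℝ) * |c * (n : ℝ) ^ (-α)| ^ 2) atTop (𝓝 0) := by
  have h1 : Tendsto (fun n : ℕ => c ^ 2 * (n : ℝ) ^ (-(2 * α - 1 / 2))) atTop (𝓝 0) :=
    tendsto_perturbation_size (by linarith)
  refine h1.congr' ?_
  filter_upwards [eventually_gt_atTop 0] with n hn
  have hn' : (0 : ℝ) < n := by exact_mod_cast hn
  rw [sq_abs, mul_pow, ← Real.rpow_natCast, ← Real.rpow_natCast, ← Real.rpow_mul hn'.le,
    Real.sqrt_eq_rpow, mul_left_comm, ← Real.rpow_add hn']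
  congr 2
  push_cast
  ring

theorem theorem3 {𝒢 : Type*} [MeasurableSpace 𝒢] {J : ℕ} (M : Market 𝒢 J)
    (Θ : Measure 𝒢) [IsProbabilityMeasure Θ]
    (π : ℝ) (hπ₀ : 0 < π) (hπ₁ : π < 1)
    (l u : Price J) (B : ℝ) (hB : 0 < B)
    (c α : ℝ) (hc : 0 < c) (hα₁ : 1 / 4 < α) (hα₂ : α < 1 / 2)
    {Ω : Type*} [MeasurableSpace Ω] (μ : Measure Ω) [IsProbabilityMeasure μ]
    (g : ℕ → Ω → 𝒢) (W : ℕ → Ω → Bool) (U : (n : ℕ) → Fin n → Ω → Price J)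
    (P : ℕ → Ω → Price J)
    (hexp : Market.IsExperiment J μ Θ π (fun n : ℕ => c * (n : ℝ) ^ (-α)) g W U)
    (hbounded : M.PricesBounded Θ l u)
    (hsmooth : M.Smooth l u)
    (hregular : M.MeanFieldRegular Θ π l u)
    (happrox : M.ApproxClears μ g W B)
    (hPmeas : ∀ n, AEMeasurable (P n) μ)
    (hP : ∀ n, ∀ᵐ ω ∂μ, M.IsClearingPrice (fun i : Fin n => g i ω) (fun i : Fin n => W i ω)
      (fun i : Fin n => U n i ω) (P n ω)) :
    (∃! pstar, M.IsMeanFieldPrice Θ π l u pstar) ∧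
      ∀ pstar, M.IsMeanFieldPrice Θ π l u pstar →
        TendstoInDistribution
          (fun (n : ℕ) ω => √(n : ℝ) *
            (M.adeEstimator π (fun i : Fin n => g i ω) (fun i : Fin n => W i ω)
              (fun i : Fin n => U n i ω) (P n ω) - M.adeLimit Θ pstar))
          atTop id (fun _ => μ) (gaussianReal 0 (M.sigmaSqD Θ π pstar).toNNReal) := by
  have := isProbabilityMeasure_treatmentLaw hπ₀.le hπ₁.le
  obtain ⟨δ, hδ, C, hC, hZ, hF, hY, hD, hS⟩ := hsmooth.exists_smoothFamily hπ₀ hπ₁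
  refine ⟨Market.existsUnique_isMeanFieldPrice hbounded hregular hπ₀.le hπ₁.le hZ hD hS hδ,
    fun p hp => ?_⟩
  have hpδ : p ∈ priceBox l u δ := priceBox_mono hδ.le hp.1
  have hm : ∀ n, AEMeasurable (fun ω => M.adeEstimator π (fun i : Fin n => g i ω)
      (fun i : Fin n => W i ω) (fun i : Fin n => U n i ω) (P n ω)) μ := fun n => by
    simp_rw [Market.adeEstimator_eq_average]
    exact aemeasurable_average fun i =>
      (M.measurable_uncurry_weightedOutcome π).comp_aemeasurable
        ((hexp.hasLaw_type_treatment i).aemeasurable.prodMk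
          ((hPmeas n).add (hexp.hasLaw_perturbation n i).aemeasurable))
  have hinflm : Measurable (M.influence Θ π p) :=
    (hF.measurable p).sub ((M.priceCorrection Θ π p).continuous.measurable.comp (hZ.measurable p))
  have hinflb : ∀ x, |M.influence Θ π p x| ≤ C + ‖M.priceCorrection Θ π p‖ * C := fun x => by
    refine (abs_sub _ _).trans (add_le_add (hF.norm_le x p hpδ) ?_)
    exact ((M.priceCorrection Θ π p).le_opNorm _).trans (by gcongr; exact hZ.norm_le x p hpδ)
  -- The price correction has mean zero because mean excess demand vanishes at `p`.
  have hmean : ∫ x, M.influence Θ π p x ∂Θ.prod (treatmentLaw π) = M.adeLimit Θ p := by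
    simp only [Market.influence]
    rw [integral_sub (hF.integrable hpδ)
      ((M.priceCorrection Θ π p).integrable_comp (hZ.integrable hpδ)),
      ContinuousLinearMap.integral_comp_comm _ (hZ.integrable hpδ),
      ← Market.meanExcess_eq_integral hπ₀.le hπ₁.le hZ hD hS hpδ, hp.2, map_zero, sub_zero,
      Market.adeLimit_eq_integral hπ₀ hπ₁ hF hY hpδ]
  have hclt := hexp.tendstoInDistribution_average hinflm hinflb
  rw [Market.sigmaSqD_eq_variance hπ₀ hπ₁ hinflm hinflb, hmean] at hclt
  -- Slutsky: the estimator and the influence average differ by `o_p(n^{-1/2})`, so the limit law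
  -- carries over.
  refine tendstoInDistribution_of_tendstoInMeasure_sub _ id hclt ?_
    fun n => ((hm n).sub_const _).const_mul _
  have := Market.tendstoInMeasure_adeEstimator_sub_average_influence hπ₀ hπ₁ hexp
    (tendsto_perturbation_size (by linarith)) (tendsto_sqrt_mul_perturbation_size_sq hα₁) hbounded
    hregular hδ hC hZ hF hY hD hS hP hm hp
  convert this using 1
  funext n ω
  simp only [Pi.sub_apply]
  ring
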